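/- Let $\mathcal S=[-1,1]^{d_S}$, $\mathcal A=[-1,1]^{d_A}$, $d=d_S+d_A$, $\nu\in\mathbb N_0$. Let $\mathcal C_p^{\nu,1}([-1,1]^d)$ be the functions on $[-1,1]^d$ whose extension to $\mathbb R^d$ with period $2$ in each coordinate is well defined and $\nu$ times continuously differentiable with Lipschitz derivatives of order $\nu$, with norm $\|f\|_{\mathcal C^{\nu,1}}=\max_{|\alpha|\le \nu+1}\|D^\alpha f\|_{L^\infty}$. Consider an MDP with states $\mathcal S$, actions $\mathcal A$, horizon $H$, transition kernels $p_h$ and deterministic rewards $R_h\in[0,1]$ ($1\le h\le H$), and let $$\mathcal T_hf(s,a)=R_h(s,a)+\mathbb E_{s'\sim p_h(\cdot|s,a)}\Big[\sup_{a'\in\mathcal A}f(s',a')\Big].$$ Assume that the MDP is $\nu$-smooth with constant $C_{\mathcal T}$: for all $1\le h\le H$ and $f\in\mathcal C_p^{\nu,1}(\mathcal S\times\mathcal A)$ one has $\mathcal T_hf\in\mathcal C_p^{\nu,1}(\mathcal S\times\mathcal A)$ and $\|\mathcal T_hf\|_{\mathcal C^{\nu,1}}\le C_{\mathcal T}(\|f\|_{\mathcal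 C^{\nu,1}}+1)$. For a positive even integer $N$ let $D_N=\frac1{N/2+1}\sum_{n=N/2}^{N}D_n^0$ be the de la Vallée-Poussin kernel on $[-1,1]^d$, where $D^0_n(z)=2^{-d}\sum_{k\in\mathbb Z^d,\ \|k\|_1\le n}e^{i\pi\langle k,z\rangle}$, and let $(D_N*f)(x)=\int_{[-1,1]^d}D_N(y)f(x-y)\,dy$ with $f$ extended periodically. Let $\mathbb T_N$ be the space of trigonometric polynomials on $[-1,1]^d$ of degree at most $N$, i.e. with frequencies $\|k\|_1\le N$. Then: (0) For every $d$ there is a constant $\Lambda_d$ with $\|D_N\|_{L^1([-1,1]^d)}\le\Lambda_d$ for all positive even $N$, and for every $d$ and $\nu$ there is a constant $K=K_{d,\nu}$ with $\inf_{t\in\mathbb T_N}\|t-f\|_{\infty}\le K N^{-(\nu+1)}\|f\|_{\mathcal C^{\nu,1}}$ for all $N\ge1$ and all $f\in\mathcal C_p^{\nu,1}([-1,1]^d)$. For any constants $\Lambda_d$ and $K$ with these properties, and any positive even $N$, let $Q^*_{H+1}=\widetilde Q_{H+1}=0$ and, for $1\le h\le H$, $Q^*_h=\mathcal T_hQ^*_{h+1}$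 and $\widetilde Q_h=D_N*\mathcal T_h\widetilde Q_{h+1}$. Then for all $1\le h\le H+1$: (1) $\widetilde Q_h\in\mathcal C_p^{\nu,1}(\mathcal S\times\mathcal A)$ and $\displaystyle\|\widetilde Q_h\|_{\mathcal C^{\nu,1}}\le\sum_{k=1}^{H-h+1}(\Lambda_dC_{\mathcal T})^k$, which equals $\dfrac{(\Lambda_dC_{\mathcal T})^{H-h+2}-\Lambda_dC_{\mathcal T}}{\Lambda_dC_{\mathcal T}-1}$ if $\Lambda_dC_{\mathcal T}\ne1$; (2) $\|\widetilde Q_h-Q^*_h\|_\infty\le\Psi_hN^{-(\nu+1)}$, where $\displaystyle\Psi_h=2^{\nu+2}K(H-h+1)\sum_{k=1}^{H-h+1}(\Lambda_dC_{\mathcal T})^k$. -/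

import Mathlib

open MeasureTheory ProbabilityTheory

open scoped NNReal ENNReal

noncomputable section

namespace ProjQ

/-! Functions on the cube and their periodic extensions. -/

/-- The cube `[-1,1]^d`. -/
abbrev Cube (d : ℕ) : Type := Set.Icc (-1 : Fin d → ℝ) 1

/-- The point of `[-1,1)^d` congruent to `x` modulo `2ℤ^d`. -/
def wrap {d : ℕ} (x : Fin d → ℝ) : Cube d :=
  ⟨fun i => toIcoMod (two_pos : (0 : ℝ) < 2) (-1) (x i),
    fun i => (toIcoMod_mem_Ico (two_pos : (0 : ℝ) < 2) (-1) (x i)).1,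
    fun i => by
      have h := (toIcoMod_mem_Ico (two_pos : (0 : ℝ) < 2) (-1) (x i)).2
      have h' : (-1 : ℝ) + 2 = 1 := by norm_num
      rw [h'] at h
      exact h.le⟩

/-- The extension of `f : [-1,1]^d → ℝ` to `ℝ^d` with period `2` in every coordinate. -/
def perExt {d : ℕ} (f : Cube d → ℝ) (x : Fin d → ℝ) : ℝ := f (wrap x)

/-- The `i`-th partial derivative. -/
def partialD {d : ℕ} (i : Fin d) (g : (Fin d → ℝ) → ℝ) (x : Fin d → ℝ) : ℝ :=
  lineDeriv ℝ g x (Pi.single i 1)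

/-- The mixed partial derivative `∂_{i₁} ⋯ ∂_{iₖ} g` for the list `[i₁, …, iₖ]`. -/
def mixedD {d : ℕ} : List (Fin d) → ((Fin d → ℝ) → ℝ) → (Fin d → ℝ) → ℝ
  | [], g => g
  | i :: l, g => partialD i (mixedD l g)

/-- `f ∈ C_p^{ν,1}([-1,1]^d)`: opposite faces match, and the periodic extension of `f` is `ν` times
continuously differentiable with Lipschitz partial derivatives of order `ν`. -/
structure MemCp {d : ℕ} (ν : ℕ) (f : Cube d → ℝ) : Prop where
  perExt_eq : ∀ z : Cube d, perExt f z = f z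
  contDiff : ContDiff ℝ ν (perExt f)
  lipschitz : ∀ l : List (Fin d), l.length = ν → ∃ L : ℝ≥0, LipschitzWith L (mixedD l (perExt f))

/-- `‖f‖_{C^{ν,1}}`: the maximum of `‖D^α f‖_{L^∞}` over all mixed partial derivatives of order at
most `ν + 1`. Those of order `ν + 1` exist almost everywhere for `f ∈ C_p^{ν,1}`. By periodicity the
essential supremum over `ℝ^d` is the one over the cube. -/
def cpNorm {d : ℕ} (ν : ℕ) (f : Cube d → ℝ) : ℝ :=
  (⨆ l : {l : List (Fin d) // l.length ≤ ν + 1},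
    eLpNorm (mixedD l.1 (perExt f)) ∞ (volume : Measure (Fin d → ℝ))).toReal

/-- Circular convolution `(g * f)(x) = ∫_{[-1,1]^d} g(y) f(x - y) dy`, with `f` extended
periodically. -/
def circConv {d : ℕ} (g : (Fin d → ℝ) → ℝ) (f : Cube d → ℝ) (x : Cube d) : ℝ :=
  ∫ y in Set.Icc (-1 : Fin d → ℝ) 1, g y * perExt f (x.1 - y)

/-! Trigonometric polynomials and the de la Vallée-Poussin kernel. -/

/-- The set of frequencies `k ∈ ℤ^d` with `‖k‖₁ ≤ n`. -/
def freqs (d n : ℕ) : Finset (Fin d → ℤ) :=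
  (Fintype.piFinset fun _ : Fin d => Finset.Icc (-(n : ℤ)) n).filter
    fun k => ∑ i, |k i| ≤ (n : ℤ)

lemma mem_freqs {d n : ℕ} {k : Fin d → ℤ} : k ∈ freqs d n ↔ ∑ i, |k i| ≤ (n : ℤ) := by
  simp only [freqs, Finset.mem_filter, Fintype.mem_piFinset, Finset.mem_Icc, and_iff_right_iff_imp]
  intro h i
  exact abs_le.mp ((Finset.single_le_sum (fun j _ => abs_nonneg (k j)) (Finset.mem_univ i)).trans h)

/-- `soc(n, z)`: `1`, `sin(nπz)` or `cos(nπz)` for `n = 0`, `n > 0`, `n < 0`. -/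
def soc (n : ℤ) (z : ℝ) : ℝ :=
  if n = 0 then 1 else if 0 < n then Real.sin (n * Real.pi * z) else Real.cos (n * Real.pi * z)

/-- The space `𝕋_N` of trigonometric polynomials of degree at most `N` on `[-1,1]^d`. -/
def trigPoly (d N : ℕ) : Submodule ℝ (Cube d → ℝ) :=
  Submodule.span ℝ ((fun (k : Fin d → ℤ) (z : Cube d) => ∏ i, soc (k i) (z.1 i)) '' (freqs d N))

/-- The Dirichlet kernel of order `n`, `2^{-d} ∑_{‖k‖₁ ≤ n} e^{iπ⟨k, z⟩}`, normalized so that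
circular convolution with it is truncation of the Fourier series to `‖k‖₁ ≤ n`. -/
def dirichletKernel (d n : ℕ) (z : Fin d → ℝ) : ℝ :=
  (1 / 2 : ℝ) ^ d * ∑ k ∈ freqs d n, Real.cos (Real.pi * ∑ i, (k i : ℝ) * z i)

/-- The de la Vallée-Poussin kernel `D_N`, for `N` even. -/
def vpKernel (d N : ℕ) (z : Fin d → ℝ) : ℝ :=
  ((N : ℝ) / 2 + 1)⁻¹ * ∑ n ∈ Finset.Icc (N / 2) N, dirichletKernel d n z

/-- `Λ` bounds the `L¹` norm of `D_N` on `[-1,1]^d` for all positive even `N`. -/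
def IsVPBound (d : ℕ) (Λ : ℝ) : Prop :=
  ∀ N : ℕ, 0 < N → Even N → ∫ y in Set.Icc (-1 : Fin d → ℝ) 1, |vpKernel d N y| ≤ Λ

/-- `K` is an admissible constant in the estimate
`inf_{t ∈ 𝕋_N} ‖t - f‖_∞ ≤ K N^{-(ν+1)} ‖f‖_{C^{ν,1}}` for `f ∈ C_p^{ν,1}([-1,1]^d)`. -/
def IsJacksonConst (d ν : ℕ) (K : ℝ) : Prop :=
  ∀ N : ℕ, 0 < N → ∀ f : Cube d → ℝ, MemCp ν f →
    ⨅ t : trigPoly d N, ⨆ z : Cube d, |t.1 z - f z| ≤ K / (N : ℝ) ^ (ν + 1) * cpNorm ν f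

/-! Markov decision processes. -/

/-- The point `(s, a)` of `[-1,1]^{dS} × [-1,1]^{dA} = [-1,1]^{dS + dA}`. -/
def join {dS dA : ℕ} (s : Cube dS) (a : Cube dA) : Cube (dS + dA) :=
  ⟨Fin.append s.1 a.1,
    fun i => by
      induction i using Fin.addCases with
      | left i => simpa using s.2.1 i
      | right i => simpa using a.2.1 i,
    fun i => by
      induction i using Fin.addCases with
      | left i => simpa using s.2.2 i
      | right i => simpa using a.2.2 i⟩

/-- A finite-horizon MDP with states `[-1,1]^{dS}` and actions `[-1,1]^{dA}`; only the stages
`1 ≤ h ≤ H` matter. -/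
structure MDP (dS dA : ℕ) where
  H : ℕ
  trans : ℕ → Kernel (Cube (dS + dA)) (Cube dS)
  markov : ∀ h, IsMarkovKernel (trans h)
  reward : ℕ → Cube (dS + dA) → ℝ
  reward_mem : ∀ h, 1 ≤ h → h ≤ H → ∀ z, reward h z ∈ Set.Icc (0 : ℝ) 1

namespace MDP

variable {dS dA : ℕ}

/-- The Bellman optimality operator
`(T_h f)(s,a) = R_h(s,a) + E_{s' ∼ p_h(·|s,a)} [sup_{a'} f(s',a')]`. -/
def bellman (M : MDP dS dA) (h : ℕ) (f : Cube (dS + dA) → ℝ) (z : Cube (dS + dA)) : ℝ :=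
  M.reward h z + ∫ s', (⨆ a' : Cube dA, f (join s' a')) ∂(M.trans h z)

/-- The MDP is `ν`-smooth with constant `C`: every `T_h` maps `C_p^{ν,1}` to itself and
`‖T_h f‖ ≤ C (‖f‖ + 1)`. -/
def IsSmooth (M : MDP dS dA) (ν : ℕ) (C : ℝ) : Prop :=
  ∀ h, 1 ≤ h → h ≤ M.H → ∀ f : Cube (dS + dA) → ℝ, MemCp ν f →
    MemCp ν (M.bellman h f) ∧ cpNorm ν (M.bellman h f) ≤ C * (cpNorm ν f + 1)

/-- `Q*` with `k` stages to go. -/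
def optQAux (M : MDP dS dA) : ℕ → Cube (dS + dA) → ℝ
  | 0 => 0
  | k + 1 => M.bellman (M.H - k) (optQAux M k)

/-- The optimal Q-function `Q*_h`, `1 ≤ h ≤ H + 1`. -/
def optQ (M : MDP dS dA) (h : ℕ) : Cube (dS + dA) → ℝ := M.optQAux (M.H + 1 - h)

/-- `Q̃` with `k` stages to go. -/
def projQAux (M : MDP dS dA) (N : ℕ) : ℕ → Cube (dS + dA) → ℝ
  | 0 => 0
  | k + 1 => circConv (vpKernel (dS + dA) N) (M.bellman (M.H - k) (projQAux M N k))

/-- The projected Q-function `Q̃_h`, `1 ≤ h ≤ H + 1`. -/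
def projQ (M : MDP dS dA) (N h : ℕ) : Cube (dS + dA) → ℝ := M.projQAux N (M.H + 1 - h)

lemma optQ_last (M : MDP dS dA) : M.optQ (M.H + 1) = 0 := by
  simp [optQ, optQAux]

lemma optQ_step (M : MDP dS dA) {h : ℕ} (h1 : 1 ≤ h) (h2 : h ≤ M.H) :
    M.optQ h = M.bellman h (M.optQ (h + 1)) := by
  obtain ⟨k, hk⟩ := Nat.exists_eq_add_of_le h2
  have e1 : M.H + 1 - h = k + 1 := by omega
  have e2 : M.H + 1 - (h + 1) = k := by omega
  have e3 : M.H - k = h := by omega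
  simp only [optQ, e1, e2, optQAux, e3]

lemma projQ_last (M : MDP dS dA) (N : ℕ) : M.projQ N (M.H + 1) = 0 := by
  simp [projQ, projQAux]

lemma projQ_step (M : MDP dS dA) (N : ℕ) {h : ℕ} (h1 : 1 ≤ h) (h2 : h ≤ M.H) :
    M.projQ N h = circConv (vpKernel (dS + dA) N) (M.bellman h (M.projQ N (h + 1))) := by
  obtain ⟨k, hk⟩ := Nat.exists_eq_add_of_le h2
  have e1 : M.H + 1 - h = k + 1 := by omega
  have e2 : M.H + 1 - (h + 1) = k := by omega
  have e3 : M.H - k = h := by omega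
  simp only [projQ, e1, e2, projQAux, e3]

end MDP

end ProjQ

end

noncomputable section
namespace ProjQ

/-! The last two claims follow by induction on the number of stages to go. Convolution with a
trigonometric kernel commutes with derivatives, so it enlarges the norm by at most the kernel's `L¹`
norm (`cpNorm_circConv_le`). One stage therefore sends a norm bound `S` to `ΛC(S + 1)`, the
recursion of the geometric sums. The error splits as `(D_N * T Q̃ - T Q̃) + (T Q̃ - T Q*)`. The
second term is controlled by the previous error, because the Bellman operator is nonexpansive in the
uniform norm (`abs_bellman_sub_le`). For the first, `D_N` reproduces polynomials `t` of degree
`N/2`, so `D_N * f - f = D_N * (f - t) + (t - f)`, which costs a factor `1 + Λ` over the best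
approximation of degree `N/2` (`abs_circConv_vpKernel_sub_le`).

The uniform `L¹` bound (`exists_isVPBound`) comes from a generating function. The sum of `z^{‖k‖₁}
e^{iπ⟨k,y⟩}` over `k` is a product of one-dimensional Poisson kernels with complex parameter `z`,
and `D_N` is obtained by integrating it over a circle `|z| = r` against a weight of size `|1 -
z|^{-2}`. By Fubini the `L¹` norm is then bounded by a one-dimensional integral of the weight times
the `d`-th power of the Poisson `L¹` norm. That norm is at most a constant times `(|1 - z|/(1 -
r))^ε` for any fixed `0 < ε ≤ 1`; taking `εd ≤ 1/2` and `1 - r` of order `1/N` closes the estimate.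

Jackson's inequality (`exists_isJacksonConst`) uses a nonnegative kernel of mass one with first
moment `O(1/N)`. If `J` is convolution with it, `I - J` gains a factor `O(1/N)` on Lipschitz
functions and commutes with derivatives, so `(I - J)^{ν+1} f` is `O(N^{-(ν+1)})`, while `f - (I -
J)^{ν+1} f` is a trigonometric polynomial. -/

/-! ### Periodic functions and integration over a period cell -/

/-- Periodicity with period `2` in every coordinate. -/
def IsPer {d : ℕ} {E : Type*} (g : (Fin d → ℝ) → E) : Prop :=
  ∀ (n : Fin d → ℤ) x, g (fun i => x i + 2 * n i) = g x

lemma exists_wrap_eq {d : ℕ} (x : Fin d → ℝ) :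
    ∃ n : Fin d → ℤ, (wrap x).1 = fun i => x i + 2 * n i := by
  refine ⟨fun i => -toIcoDiv (two_pos : (0 : ℝ) < 2) (-1) (x i), ?_⟩
  funext i
  simp only [wrap, toIcoMod, zsmul_eq_mul]
  push_cast
  ring

lemma wrap_add {d : ℕ} (n : Fin d → ℤ) (x : Fin d → ℝ) :
    wrap (fun i => x i + 2 * n i) = wrap x := by
  apply Subtype.ext
  funext i
  have := toIcoMod_add_zsmul (two_pos : (0 : ℝ) < 2) (-1) (x i) (n i)
  simp only [wrap]
  rw [← this, zsmul_eq_mul, mul_comm]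

lemma isPer_perExt {d : ℕ} (f : Cube d → ℝ) : IsPer (perExt f) := fun n x => by
  rw [perExt, wrap_add, perExt]

lemma IsPer.wrap {d : ℕ} {E : Type*} {g : (Fin d → ℝ) → E} (hg : IsPer g) (x : Fin d → ℝ) :
    g (wrap x).1 = g x := by
  obtain ⟨n, hn⟩ := exists_wrap_eq x
  rw [hn, hg]

lemma IsPer.sub_right {d : ℕ} {E : Type*} {g : (Fin d → ℝ) → E} (hg : IsPer g)
    (y : Fin d → ℝ) : IsPer fun x => g (x - y) := fun n x => by
  change g _ = g _
  rw [← hg n (x - y)]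
  congr 1
  funext i
  simp only [Pi.sub_apply]
  ring

lemma IsPer.sub_left {d : ℕ} {E : Type*} {g : (Fin d → ℝ) → E} (hg : IsPer g)
    (x : Fin d → ℝ) : IsPer fun y => g (x - y) := fun n y => by
  change g _ = g _
  rw [← hg (-n) (x - y)]
  congr 1
  funext i
  simp only [Pi.sub_apply, Pi.neg_apply]
  push_cast
  ring

/-- The basis `2e_i` of the lattice `2ℤ^d`. -/
def latticeBasis (d : ℕ) : Module.Basis (Fin d) ℝ (Fin d → ℝ) :=
  (Pi.basisFun ℝ (Fin d)).unitsSMul fun _ => Units.mk0 2 two_ne_zero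

lemma latticeBasis_repr {d : ℕ} (x : Fin d → ℝ) (i : Fin d) :
    (latticeBasis d).repr x i = x i / 2 := by
  rw [latticeBasis, Module.Basis.repr_unitsSMul]
  simp [Units.smul_def]
  ring

lemma IsPer.vadd {d : ℕ} {E : Type*} {g : (Fin d → ℝ) → E} (hg : IsPer g)
    (n : Submodule.span ℤ (Set.range (latticeBasis d))) (x : Fin d → ℝ) : g (n +ᵥ x) = g x := by
  have h := ((latticeBasis d).mem_span_iff_repr_mem ℤ n.1).1 n.2
  choose k hk using h
  rw [← hg k x]
  congr 1
  funext i
  have := hk i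
  rw [latticeBasis_repr] at this
  simp only [algebraMap_int_eq, eq_intCast] at this
  rw [Submodule.vadd_def, vadd_eq_add, Pi.add_apply, this]
  ring

/-- The fundamental domain of the basis `2e_i` is `[0,2)^d`; hence the shift by `1`. The faces are
null. -/
lemma cube_ae_eq (d : ℕ) : (Set.Icc (-1 : Fin d → ℝ) 1) =ᵐ[volume]
    ((fun y : Fin d → ℝ => 1 + y) ⁻¹' ZSpan.fundamentalDomain (latticeBasis d)) := by
  have : ((fun y : Fin d → ℝ => 1 + y) ⁻¹' ZSpan.fundamentalDomain (latticeBasis d))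
      = Set.univ.pi fun i : Fin d => Set.Ico (-1 : ℝ) 1 := by
    ext y
    simp only [Set.mem_preimage, ZSpan.mem_fundamentalDomain, latticeBasis_repr, Set.mem_pi,
      Set.mem_univ, true_imp_iff, Set.mem_Ico, Pi.add_apply, Pi.one_apply]
    refine forall_congr' fun i => ?_
    constructor <;> rintro ⟨h1, h2⟩ <;> constructor <;> linarith
  rw [this]
  have h := (Measure.univ_pi_Ico_ae_eq_Icc (μ := fun _ : Fin d => (volume : Measure ℝ))
    (f := -1) (g := 1)).symm
  simpa [volume_pi] using h

/-- A measure-preserving map that intertwines lattice translations up to the sign `ε` pulls a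
fundamental domain back to another one, and periodic functions have the same integral over both. The
sign covers translations and reflections together. -/
lemma IsPer.integral_preimage {d : ℕ} {E : Type*} [NormedAddCommGroup E] [NormedSpace ℝ E]
    {g : (Fin d → ℝ) → E} (hg : IsPer g) {φ : (Fin d → ℝ) → Fin d → ℝ}
    (hφ : MeasurePreserving φ) (ε : ℤ) (hε : ε * ε = 1) (hv : ∀ v y, φ (ε • v + y) = v + φ y) :
    ∫ y in φ ⁻¹' ZSpan.fundamentalDomain (latticeBasis d), g y
      = ∫ y in ZSpan.fundamentalDomain (latticeBasis d), g y := by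
  have h0 := ZSpan.isAddFundamentalDomain (latticeBasis d) (volume : Measure (Fin d → ℝ))
  have : VAddInvariantMeasure (Submodule.span ℤ (Set.range (latticeBasis d))) (Fin d → ℝ)
      volume := ⟨fun v s _ => measure_preimage_add volume v.1 s⟩
  have hcount : Countable (Submodule.span ℤ (Set.range (latticeBasis d))) := inferInstance
  refine IsAddFundamentalDomain.setIntegral_eq ?_ h0 hg.vadd
  refine h0.preimage_of_equiv hφ.quasiMeasurePreserving (e := fun v => ε • v) ?_ ?_
  · refine Function.bijective_iff_has_inverse.2 ⟨fun v => ε • v, ?_, ?_⟩ <;> intro v <;>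
      simp only [smul_smul, hε, one_smul]
  · intro v y
    exact hv v.1 y

lemma IsPer.integral_cube {d : ℕ} {E : Type*} [NormedAddCommGroup E] [NormedSpace ℝ E]
    {g : (Fin d → ℝ) → E} (hg : IsPer g) :
    ∫ y in Set.Icc (-1 : Fin d → ℝ) 1, g y
      = ∫ y in ZSpan.fundamentalDomain (latticeBasis d), g y := by
  rw [setIntegral_congr_set (cube_ae_eq d)]
  refine hg.integral_preimage (measurePreserving_add_left _ 1) 1 (by norm_num) fun v y => ?_
  simp only [one_smul]
  exact add_left_comm _ _ _

/-- The integral of a periodic function over the cube is invariant under `y ↦ x - y`. -/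
lemma IsPer.integral_sub_left {d : ℕ} {E : Type*} [NormedAddCommGroup E] [NormedSpace ℝ E]
    {g : (Fin d → ℝ) → E} (hg : IsPer g) (x : Fin d → ℝ) :
    ∫ y in Set.Icc (-1 : Fin d → ℝ) 1, g (x - y) = ∫ y in Set.Icc (-1 : Fin d → ℝ) 1, g y := by
  rw [hg.integral_cube, (hg.sub_left x).integral_cube]
  have hp : MeasurePreserving (fun y : Fin d → ℝ => x - y) :=
    Measure.measurePreserving_sub_left _ x
  rw [← (hg.sub_left x).integral_preimage hp (-1) (by norm_num) fun v y => by
    simp only [neg_smul, one_smul]; abel]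
  exact hp.setIntegral_preimage_emb (MeasurableEquiv.subLeft x).measurableEmbedding g _

/-! Exponentials. -/

/-- `e^{iπt}`. -/
def circ (t : ℝ) : ℂ := Complex.exp ((Real.pi * t : ℝ) * Complex.I)

/-- `e^{iπ⟨k, x⟩}`. -/
def expo {d : ℕ} (k : Fin d → ℤ) (x : Fin d → ℝ) : ℂ := ∏ i, circ (k i * x i)

lemma circ_add (s t : ℝ) : circ (s + t) = circ s * circ t := by
  rw [circ, circ, circ, ← Complex.exp_add]
  congr 1
  push_cast
  ring

@[simp] lemma circ_zero : circ 0 = 1 := by simp [circ]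

@[simp] lemma norm_circ (t : ℝ) : ‖circ t‖ = 1 := Complex.norm_exp_ofReal_mul_I _

lemma circ_ne_zero (t : ℝ) : circ t ≠ 0 := Complex.exp_ne_zero _

lemma circ_neg (t : ℝ) : circ (-t) = (circ t)⁻¹ := by
  refine eq_inv_of_mul_eq_one_left ?_
  rw [← circ_add, neg_add_cancel, circ_zero]

lemma circ_int_mul (n : ℤ) (t : ℝ) : circ (n * t) = circ t ^ n := by
  rw [circ, circ, ← Complex.exp_int_mul]
  congr 1
  push_cast
  ring

lemma circ_nat_mul (n : ℕ) (t : ℝ) : circ (n * t) = circ t ^ n := by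
  have := circ_int_mul n t
  simpa using this

lemma circ_two_int (n : ℤ) : circ (2 * n) = 1 := by
  rw [circ, Complex.exp_eq_one_iff]
  exact ⟨n, by push_cast; ring⟩

lemma circ_eq (t : ℝ) : circ t = Real.cos (Real.pi * t) + Real.sin (Real.pi * t) * Complex.I := by
  rw [circ, Complex.exp_mul_I, Complex.ofReal_cos, Complex.ofReal_sin]

lemma circ_sum {ι : Type*} (s : Finset ι) (f : ι → ℝ) : circ (∑ i ∈ s, f i) = ∏ i ∈ s, circ (f i) := by
  classical
  induction s using Finset.induction_on with
  | empty => simp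
  | insert a s ha ih => rw [Finset.sum_insert ha, Finset.prod_insert ha, circ_add, ih]

lemma contDiff_circ : ContDiff ℝ ⊤ circ := by
  unfold circ
  refine ContDiff.cexp (ContDiff.mul ?_ contDiff_const)
  exact Complex.ofRealCLM.contDiff.comp (contDiff_const.mul contDiff_id)

@[fun_prop] lemma continuous_circ : Continuous circ := contDiff_circ.continuous

lemma contDiff_expo {d : ℕ} (k : Fin d → ℤ) : ContDiff ℝ ⊤ (expo k) := by
  unfold expo
  refine contDiff_prod fun i _ => contDiff_circ.comp ?_
  exact contDiff_const.mul (contDiff_apply ℝ ℝ i)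

@[fun_prop] lemma continuous_expo {d : ℕ} (k : Fin d → ℤ) : Continuous (expo k) :=
  (contDiff_expo k).continuous

lemma expo_eq {d : ℕ} (k : Fin d → ℤ) (x : Fin d → ℝ) : expo k x = circ (∑ i, k i * x i) :=
  (circ_sum _ _).symm

lemma re_expo {d : ℕ} (k : Fin d → ℤ) (x : Fin d → ℝ) :
    (expo k x).re = Real.cos (Real.pi * ∑ i, (k i : ℝ) * x i) := by
  rw [expo_eq, circ_eq]
  simp [-Complex.ofReal_sum, -Complex.ofReal_mul, -Complex.ofReal_cos, -Complex.ofReal_sin]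

lemma expo_add {d : ℕ} (k : Fin d → ℤ) (x y : Fin d → ℝ) :
    expo k (x + y) = expo k x * expo k y := by
  simp only [expo, ← Finset.prod_mul_distrib, Pi.add_apply, mul_add, circ_add]

lemma expo_sub {d : ℕ} (k : Fin d → ℤ) (x y : Fin d → ℝ) :
    expo k (x - y) = expo k x * expo k (-y) := by
  rw [sub_eq_add_neg, expo_add]

lemma isPer_expo {d : ℕ} (k : Fin d → ℤ) : IsPer (expo k) := fun n x => by
  simp only [expo]
  refine Finset.prod_congr rfl fun i _ => ?_
  have : (k i : ℝ) * (x i + 2 * n i) = k i * x i + 2 * ((k i * n i : ℤ) : ℝ) := by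
    push_cast; ring
  rw [this, circ_add, circ_two_int, mul_one]

lemma integral_circ (n : ℤ) : ∫ t in (-1 : ℝ)..1, circ (n * t) = if n = 0 then 2 else 0 := by
  split_ifs with h
  · subst h
    simp
    norm_num
  · have hc : ((Real.pi * n : ℝ) * Complex.I : ℂ) ≠ 0 := by
      simp [Real.pi_ne_zero, h]
    have h1 : ∀ t : ℝ, circ (n * t) = Complex.exp ((Real.pi * n : ℝ) * Complex.I * t) := fun t => by
      rw [circ]; congr 1; push_cast; ring
    simp only [h1]
    rw [integral_exp_mul_complex hc, div_eq_zero_iff]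
    left
    have h2 := circ_two_int n
    have h3 : circ (n * 1) = circ (n * (-1)) := by
      rw [← mul_one (circ (n * (-1))), ← h2, ← circ_add]; congr 1; ring
    rw [sub_eq_zero, ← h1, ← h1, h3]

/-- Integrals of products over the cube. -/
lemma integral_cube_prod {𝕜 : Type*} [RCLike 𝕜] {d : ℕ} (f : Fin d → ℝ → 𝕜) :
    ∫ y in Set.Icc (-1 : Fin d → ℝ) 1, ∏ i, f i (y i) = ∏ i, ∫ t in (-1 : ℝ)..1, f i t := by
  have : (volume : Measure (Fin d → ℝ)).restrict (Set.Icc (-1 : Fin d → ℝ) 1)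
      = Measure.pi fun _ : Fin d => (volume : Measure ℝ).restrict (Set.Icc (-1) 1) := by
    rw [← Measure.restrict_pi_pi, volume_pi, Set.pi_univ_Icc]
    rfl
  rw [this, integral_fintype_prod_eq_prod]
  refine Finset.prod_congr rfl fun i _ => ?_
  rw [intervalIntegral.integral_of_le (by norm_num), integral_Icc_eq_integral_Ioc]

lemma integral_expo_mul {d : ℕ} (j k : Fin d → ℤ) :
    ∫ y in Set.Icc (-1 : Fin d → ℝ) 1, expo j y * expo k (-y) = if j = k then 2 ^ d else 0 := by
  have h : ∀ y : Fin d → ℝ, expo j y * expo k (-y) = ∏ i, circ (((j i - k i : ℤ) : ℝ) * y i) := by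
    intro y
    simp only [expo, ← Finset.prod_mul_distrib, ← circ_add, Pi.neg_apply]
    refine Finset.prod_congr rfl fun i _ => ?_
    congr 1
    push_cast; ring
  simp only [h]
  rw [integral_cube_prod (fun i t => circ (((j i - k i : ℤ) : ℝ) * t))]
  simp only [integral_circ, sub_eq_zero]
  split_ifs with hjk
  · subst hjk; simp
  · obtain ⟨i, hi⟩ := Function.ne_iff.1 hjk
    exact Finset.prod_eq_zero (Finset.mem_univ i) (by simp [hi])

/-! ### Real and complex trigonometric polynomials -/

/-- Euler's formula in a form indexed by `Bool`, so that a product over coordinates expands into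
terms indexed by sign choices. Since every `|k i|` is kept, the `ℓ¹` degree does not change. -/
lemma circ_eq_sum_soc (k : ℤ) : ∃ (a : Bool → ℂ) (s : Bool → ℤ), (∀ b, |s b| = |k|) ∧
    ∀ t : ℝ, circ (k * t) = ∑ b, a b * (soc (s b) t : ℂ) := by
  rcases lt_trichotomy k 0 with hk | hk | hk
  · refine ⟨fun b => if b then 1 else -Complex.I, fun b => if b then k else -k,
      fun b => by cases b <;> simp, fun t => ?_⟩
    have h1 : soc k t = Real.cos (Real.pi * (k * t)) := by
      rw [soc, if_neg hk.ne, if_neg hk.not_gt]; congr 1; ring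
    have h2 : soc (-k) t = -Real.sin (Real.pi * (k * t)) := by
      rw [soc, if_neg (by omega), if_pos (by omega), ← Real.sin_neg]; congr 1; push_cast; ring
    simp only [Fintype.univ_bool, Finset.mem_singleton, Bool.true_eq_false, not_false_eq_true,
      Finset.sum_insert, Finset.sum_singleton, if_true, Bool.false_eq_true, if_false]
    rw [h1, h2, circ_eq]
    push_cast; ring
  · subst hk
    refine ⟨fun b => if b then 1 else 0, fun _ => 0, fun b => by simp, fun t => ?_⟩
    simp [soc]
  · refine ⟨fun b => if b then 1 else Complex.I, fun b => if b then -k else k,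
      fun b => by cases b <;> simp, fun t => ?_⟩
    have h1 : soc k t = Real.sin (Real.pi * (k * t)) := by
      rw [soc, if_neg hk.ne', if_pos hk]; congr 1; ring
    have h2 : soc (-k) t = Real.cos (Real.pi * (k * t)) := by
      rw [soc, if_neg (by omega), if_neg (by omega), ← Real.cos_neg]; congr 1; push_cast; ring
    simp only [Fintype.univ_bool, Finset.mem_singleton, Bool.true_eq_false, not_false_eq_true,
      Finset.sum_insert, Finset.sum_singleton, if_true, Bool.false_eq_true, if_false]
    rw [h1, h2, circ_eq]
    push_cast; ring

lemma soc_eq_sum_circ (k : ℤ) : ∃ (a : Bool → ℂ) (s : Bool → ℤ), (∀ b, |s b| = |k|) ∧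
    ∀ t : ℝ, (soc k t : ℂ) = ∑ b, a b * circ (s b * t) := by
  have hc : ∀ t : ℝ, circ (k * t) =
      Real.cos (Real.pi * (k * t)) + Real.sin (Real.pi * (k * t)) * Complex.I := fun t => circ_eq _
  have hs : ∀ t : ℝ, circ ((-k : ℤ) * t) =
      Real.cos (Real.pi * (k * t)) - Real.sin (Real.pi * (k * t)) * Complex.I := fun t => by
    have : Real.pi * ((-k : ℤ) * t) = -(Real.pi * (k * t)) := by push_cast; ring
    rw [circ_eq, this, Real.cos_neg, Real.sin_neg]
    push_cast; ring
  rcases lt_trichotomy k 0 with hk | hk | hk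
  · refine ⟨fun _ => 1 / 2, fun b => if b then k else -k,
      fun b => by cases b <;> simp, fun t => ?_⟩
    have h1 : soc k t = Real.cos (Real.pi * (k * t)) := by
      rw [soc, if_neg hk.ne, if_neg hk.not_gt]; congr 1; ring
    simp only [Fintype.univ_bool, Finset.mem_singleton, Bool.true_eq_false, not_false_eq_true,
      Finset.sum_insert, Finset.sum_singleton, if_true, Bool.false_eq_true, if_false]
    rw [h1, hc, hs]
    ring
  · subst hk
    refine ⟨fun b => if b then 1 else 0, fun _ => 0, fun b => by simp, fun t => ?_⟩
    simp [soc]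
  · refine ⟨fun b => if b then -Complex.I / 2 else Complex.I / 2, fun b => if b then k else -k,
      fun b => by cases b <;> simp, fun t => ?_⟩
    have h1 : soc k t = Real.sin (Real.pi * (k * t)) := by
      rw [soc, if_neg hk.ne', if_pos hk]; congr 1; ring
    simp only [Fintype.univ_bool, Finset.mem_singleton, Bool.true_eq_false, not_false_eq_true,
      Finset.sum_insert, Finset.sum_singleton, if_true, Bool.false_eq_true, if_false]
    rw [h1, hc, hs]
    linear_combination (Real.sin (Real.pi * (k * t)) : ℂ) * Complex.I_mul_I

/-- Complex trigonometric polynomials of degree at most `N` on `ℝ^d`. -/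
def trigSpan (d N : ℕ) : Submodule ℂ ((Fin d → ℝ) → ℂ) :=
  Submodule.span ℂ (expo '' (freqs d N))

lemma expo_mem_trigSpan {d N : ℕ} {k : Fin d → ℤ} (hk : k ∈ freqs d N) :
    expo k ∈ trigSpan d N := Submodule.subset_span ⟨k, hk, rfl⟩

lemma neg_mem_freqs {d N : ℕ} {k : Fin d → ℤ} (hk : k ∈ freqs d N) : -k ∈ freqs d N := by
  rw [mem_freqs] at hk ⊢
  simpa using hk

lemma freqs_mono {d m n : ℕ} (h : m ≤ n) {k : Fin d → ℤ} (hk : k ∈ freqs d m) :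
    k ∈ freqs d n := by
  rw [mem_freqs] at hk ⊢
  omega

lemma mem_freqs_congr {d N : ℕ} {k l : Fin d → ℤ} (hk : k ∈ freqs d N)
    (h : ∀ i, |l i| = |k i|) : l ∈ freqs d N := by
  rw [mem_freqs] at hk ⊢
  simpa only [h] using hk

lemma isPer_of_mem_trigSpan {d N : ℕ} {T : (Fin d → ℝ) → ℂ} (hT : T ∈ trigSpan d N) :
    IsPer T := by
  induction hT using Submodule.span_induction with
  | mem T h => obtain ⟨k, -, rfl⟩ := h; exact isPer_expo k
  | zero => exact fun n x => rfl
  | add S T _ _ hS hT => exact fun n x => by simp only [Pi.add_apply, hS n x, hT n x]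
  | smul c T _ hT => exact fun n x => by simp only [Pi.smul_apply, hT n x]

lemma contDiff_of_mem_trigSpan {d N : ℕ} {T : (Fin d → ℝ) → ℂ} (hT : T ∈ trigSpan d N) :
    ContDiff ℝ ⊤ T := by
  induction hT using Submodule.span_induction with
  | mem T h => obtain ⟨k, -, rfl⟩ := h; exact contDiff_expo k
  | zero => exact contDiff_const
  | add S T _ _ hS hT => exact hS.add hT
  | smul c T _ hT => exact contDiff_const.smul hT

/-- The restriction to the cube of the real part of a complex trigonometric polynomial is a
trigonometric polynomial. -/
lemma re_mem_trigPoly {d N : ℕ} {T : (Fin d → ℝ) → ℂ} (hT : T ∈ trigSpan d N) :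
    (fun z : Cube d => (T z.1).re) ∈ trigPoly d N := by
  -- The factor `c` makes the claim stable under complex scalars, as span induction requires.
  suffices h : ∀ c : ℂ, (fun z : Cube d => (c * T z.1).re) ∈ trigPoly d N by simpa using h 1
  induction hT using Submodule.span_induction with
  | mem T h =>
    obtain ⟨k, hk, rfl⟩ := h
    intro c
    choose a s hs h using fun i => circ_eq_sum_soc (k i)
    have : (fun z : Cube d => (c * expo k z.1).re) = ∑ β ∈ Fintype.piFinset fun _ : Fin d =>
        (Finset.univ : Finset Bool), (c * ∏ i, a i (β i)).re •
          fun z : Cube d => ∏ i, soc (s i (β i)) (z.1 i) := by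
      funext z
      simp only [expo, h, Finset.prod_univ_sum, Finset.sum_apply, Pi.smul_apply, smul_eq_mul,
        Finset.mul_sum, Complex.re_sum]
      refine Finset.sum_congr rfl fun β _ => ?_
      rw [Finset.prod_mul_distrib, ← mul_assoc, ← Complex.ofReal_prod, Complex.re_mul_ofReal]
    rw [this]
    refine Submodule.sum_mem _ fun β _ => Submodule.smul_mem _ _ (Submodule.subset_span ?_)
    exact ⟨fun i => s i (β i), mem_freqs_congr hk fun i => hs i _, rfl⟩
  | zero =>
    intro c
    simp only [Pi.zero_apply, mul_zero, Complex.zero_re]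
    exact (trigPoly d N).zero_mem
  | add S T _ _ hS hT =>
    intro c
    simp only [Pi.add_apply, mul_add, Complex.add_re]
    exact Submodule.add_mem _ (hS c) (hT c)
  | smul b T _ hT =>
    intro c
    simpa only [Pi.smul_apply, smul_eq_mul, mul_assoc] using hT (c * b)

lemma exists_trigSpan_of_mem_trigPoly {d N : ℕ} {t : Cube d → ℝ} (ht : t ∈ trigPoly d N) :
    ∃ T ∈ trigSpan d N, ∀ z : Cube d, T z.1 = t z := by
  induction ht using Submodule.span_induction with
  | mem t h =>
    obtain ⟨k, hk, rfl⟩ := h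
    choose a s hs h using fun i => soc_eq_sum_circ (k i)
    refine ⟨∑ β ∈ Fintype.piFinset fun _ : Fin d => (Finset.univ : Finset Bool),
      (∏ i, a i (β i)) • expo fun i => s i (β i), ?_, fun z => ?_⟩
    · exact Submodule.sum_mem _ fun β _ => Submodule.smul_mem _ _
        (expo_mem_trigSpan (mem_freqs_congr hk fun i => hs i _))
    · simp only [Complex.ofReal_prod, h, Finset.prod_univ_sum, Finset.sum_apply, Pi.smul_apply,
        smul_eq_mul, expo, Finset.prod_mul_distrib]
  | zero => exact ⟨0, Submodule.zero_mem _, fun z => by simp⟩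
  | add s t _ _ hs ht =>
    obtain ⟨S, hS, h1⟩ := hs
    obtain ⟨T, hT, h2⟩ := ht
    exact ⟨S + T, Submodule.add_mem _ hS hT, fun z => by simp [h1, h2]⟩
  | smul c t _ ht =>
    obtain ⟨T, hT, h2⟩ := ht
    exact ⟨(c : ℂ) • T, Submodule.smul_mem _ _ hT, fun z => by simp [h2]⟩

/-- A real function on `ℝ^d` is a trigonometric polynomial of degree at most `N`. -/
def IsTrig {d : ℕ} (N : ℕ) (G : (Fin d → ℝ) → ℝ) : Prop :=
  (fun x => (G x : ℂ)) ∈ trigSpan d N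

lemma IsTrig.isPer {d N : ℕ} {G : (Fin d → ℝ) → ℝ} (hG : IsTrig N G) : IsPer G := fun n x => by
  have := isPer_of_mem_trigSpan hG n x
  exact_mod_cast this

lemma IsTrig.contDiff {d N : ℕ} {G : (Fin d → ℝ) → ℝ} (hG : IsTrig N G) : ContDiff ℝ ⊤ G :=
  Complex.reCLM.contDiff.comp (contDiff_of_mem_trigSpan hG)

lemma IsTrig.mem_trigPoly {d N : ℕ} {G : (Fin d → ℝ) → ℝ} (hG : IsTrig N G) :
    (fun z : Cube d => G z.1) ∈ trigPoly d N := re_mem_trigPoly hG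

lemma IsTrig.sum {d N : ℕ} {ι : Type*} {s : Finset ι} {G : ι → (Fin d → ℝ) → ℝ}
    (h : ∀ i ∈ s, IsTrig N (G i)) : IsTrig N fun x => ∑ i ∈ s, G i x := by
  unfold IsTrig
  have : (fun x => ((∑ i ∈ s, G i x : ℝ) : ℂ)) = ∑ i ∈ s, fun x => (G i x : ℂ) := by
    funext x; simp
  rw [this]
  exact Submodule.sum_mem _ h

lemma IsTrig.const_mul {d N : ℕ} {G : (Fin d → ℝ) → ℝ} (hG : IsTrig N G) (c : ℝ) :
    IsTrig N fun x => c * G x := by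
  have := Submodule.smul_mem _ (c : ℂ) hG
  unfold IsTrig
  convert this using 2 with x
  simp

lemma IsTrig.add {d N : ℕ} {F G : (Fin d → ℝ) → ℝ} (hF : IsTrig N F) (hG : IsTrig N G) :
    IsTrig N (F + G) := by
  have := Submodule.add_mem _ hF hG
  unfold IsTrig
  convert this using 2 with x
  simp

lemma isTrig_zero {d N : ℕ} : IsTrig N (0 : (Fin d → ℝ) → ℝ) := by
  unfold IsTrig
  convert (trigSpan d N).zero_mem using 2 with x
  simp

/-! ### Trigonometric kernels and the polynomials they reproduce -/

/-- Convolution over the cube of functions on `ℝ^d`. -/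
def conv {d : ℕ} (K g : (Fin d → ℝ) → ℝ) (x : Fin d → ℝ) : ℝ :=
  ∫ y in Set.Icc (-1 : Fin d → ℝ) 1, K y * g (x - y)

lemma conv_eq {d : ℕ} {K g : (Fin d → ℝ) → ℝ} (hK : IsPer K) (hg : IsPer g) (x : Fin d → ℝ) :
    conv K g x = ∫ y in Set.Icc (-1 : Fin d → ℝ) 1, K (x - y) * g y := by
  have hH : IsPer fun u => K u * g (x - u) := fun n u => by
    have h1 := hK n u
    have h2 := hg.sub_left x n u
    simp only at h2 ⊢
    rw [h1, h2]
  rw [conv, ← hH.integral_sub_left x]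
  simp

lemma integrableOn_cube {d : ℕ} {E : Type*} [NormedAddCommGroup E] {g : (Fin d → ℝ) → E}
    (hg : Continuous g) : IntegrableOn g (Set.Icc (-1) 1) :=
  hg.continuousOn.integrableOn_compact isCompact_Icc

/-- An exponential of `x - y` separates into a function of `x` times one of `y`. -/
lemma integral_mem_trigSpan {d N : ℕ} {T : (Fin d → ℝ) → ℂ} (hT : T ∈ trigSpan d N)
    {g : (Fin d → ℝ) → ℂ} (hg : Continuous g) :
    (fun x => ∫ y in Set.Icc (-1 : Fin d → ℝ) 1, T (x - y) * g y) ∈ trigSpan d N := by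
  induction hT using Submodule.span_induction with
  | mem T h =>
    obtain ⟨k, hk, rfl⟩ := h
    have : (fun x => ∫ y in Set.Icc (-1 : Fin d → ℝ) 1, expo k (x - y) * g y)
        = (∫ y in Set.Icc (-1 : Fin d → ℝ) 1, expo k (-y) * g y) • expo k := by
      funext x
      simp only [expo_sub, mul_assoc, integral_const_mul, Pi.smul_apply, smul_eq_mul]
      ring
    rw [this]
    exact Submodule.smul_mem _ _ (expo_mem_trigSpan hk)
  | zero =>
    simp only [Pi.zero_apply, zero_mul, integral_zero]
    exact (trigSpan d N).zero_mem
  | add S T hS hT h1 h2 =>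
    convert Submodule.add_mem _ h1 h2 using 1
    funext x
    have := (contDiff_of_mem_trigSpan hS).continuous
    have := (contDiff_of_mem_trigSpan hT).continuous
    simp only [Pi.add_apply, add_mul]
    exact integral_add (integrableOn_cube (by fun_prop)) (integrableOn_cube (by fun_prop))
  | smul c T _ hT =>
    convert Submodule.smul_mem _ c hT using 1
    funext x
    simp only [Pi.smul_apply, smul_eq_mul, mul_assoc, integral_const_mul]

lemma IsTrig.conv {d N : ℕ} {K g : (Fin d → ℝ) → ℝ} (hK : IsTrig N K) (hg : IsPer g)
    (hc : Continuous g) : IsTrig N (conv K g) := by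
  unfold IsTrig
  convert integral_mem_trigSpan hK (g := fun x => (g x : ℂ)) (by fun_prop) using 2 with x
  rw [conv_eq hK.isPer hg, ← integral_complex_ofReal]
  simp

lemma dirichletKernel_eq (d n : ℕ) (z : Fin d → ℝ) :
    (dirichletKernel d n z : ℂ) = (1 / 2 : ℂ) ^ d * ∑ k ∈ freqs d n, expo k z := by
  have hs : ∑ k ∈ freqs d n, expo k z = ((∑ k ∈ freqs d n, (expo k z).re : ℝ) : ℂ) := by
    have h1 : ∑ k ∈ freqs d n, expo k z = ∑ k ∈ freqs d n, expo (-k) z :=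
      Finset.sum_nbij' (fun k => -k) (fun k => -k) (fun k hk => neg_mem_freqs hk)
        (fun k hk => neg_mem_freqs hk) (fun k _ => neg_neg k) (fun k _ => neg_neg k)
        (fun k _ => by rw [neg_neg])
    have h2 : ∀ k : Fin d → ℤ, (2 : ℂ) * ((expo k z).re : ℝ) = expo k z + expo (-k) z := fun k => by
      have : expo (-k) z = circ (-∑ i, k i * z i) := by
        rw [expo_eq]; congr 1; simp
      rw [re_expo, expo_eq, this, circ_eq, circ_eq, mul_neg, Real.cos_neg, Real.sin_neg]
      push_cast; ring
    have h3 : (2 : ℂ) * ((∑ k ∈ freqs d n, (expo k z).re : ℝ) : ℂ)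
        = 2 * ∑ k ∈ freqs d n, expo k z := by
      rw [Complex.ofReal_sum, Finset.mul_sum]
      simp only [h2]
      rw [Finset.sum_add_distrib, ← h1]; ring
    exact (mul_left_cancel₀ two_ne_zero h3).symm
  rw [hs, dirichletKernel]
  simp only [re_expo]
  push_cast
  rfl

lemma isTrig_dirichletKernel {d n N : ℕ} (h : n ≤ N) : IsTrig N (dirichletKernel d n) := by
  unfold IsTrig
  have : (fun z => (dirichletKernel d n z : ℂ)) = (1 / 2 : ℂ) ^ d • ∑ k ∈ freqs d n, expo k := by
    funext z
    simp [dirichletKernel_eq]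
  rw [this]
  exact Submodule.smul_mem _ _ (Submodule.sum_mem _ fun k hk =>
    expo_mem_trigSpan (freqs_mono h hk))

lemma isTrig_vpKernel (d N : ℕ) : IsTrig N (vpKernel d N) :=
  (IsTrig.sum fun _ hn => isTrig_dirichletKernel (Finset.mem_Icc.1 hn).2).const_mul _

lemma dirichletKernel_expo {d n : ℕ} {j : Fin d → ℤ} (hj : j ∈ freqs d n) (x : Fin d → ℝ) :
    ∫ y in Set.Icc (-1 : Fin d → ℝ) 1, (dirichletKernel d n y : ℂ) * expo j (x - y)
      = expo j x := by
  have : ∀ y, (dirichletKernel d n y : ℂ) * expo j (x - y)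
      = (1 / 2 : ℂ) ^ d * expo j x * ∑ k ∈ freqs d n, expo k y * expo j (-y) := fun y => by
    rw [dirichletKernel_eq, expo_sub, Finset.mul_sum, Finset.mul_sum, Finset.sum_mul]
    exact Finset.sum_congr rfl fun k _ => by ring
  simp only [this]
  have hn : Continuous fun y : Fin d → ℝ => expo j (-y) := (continuous_expo j).comp continuous_neg
  rw [integral_const_mul, integral_finsetSum _ fun k _ => integrableOn_cube (by fun_prop)]
  simp only [integral_expo_mul, Finset.sum_ite_eq', hj, if_true]
  rw [mul_right_comm, ← mul_pow]
  norm_num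

/-- Each averaged Dirichlet kernel has order at least `N / 2` and so fixes this exponential. For
even `N` there are exactly `N / 2 + 1` of them, which matches the normalization. -/
lemma vpKernel_expo {d N : ℕ} (hN : Even N) {j : Fin d → ℤ}
    (hj : j ∈ freqs d (N / 2)) (x : Fin d → ℝ) :
    ∫ y in Set.Icc (-1 : Fin d → ℝ) 1, (vpKernel d N y : ℂ) * expo j (x - y) = expo j x := by
  obtain ⟨m, rfl⟩ := hN
  have h2 : (m + m) / 2 = m := by omega
  have : ∀ y, (vpKernel d (m + m) y : ℂ) * expo j (x - y) = ((m : ℂ) + 1)⁻¹ *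
      ∑ n ∈ Finset.Icc m (m + m), (dirichletKernel d n y : ℂ) * expo j (x - y) := fun y => by
    rw [vpKernel, h2, ← Finset.sum_mul]
    push_cast
    have : ((m : ℂ) + m) / 2 = m := by ring
    rw [this]; ring
  have hc : ∀ n, Continuous fun y => (dirichletKernel d n y : ℂ) := fun n =>
    Complex.continuous_ofReal.comp (isTrig_dirichletKernel le_rfl).contDiff.continuous
  have hn : Continuous fun y : Fin d → ℝ => expo j (x - y) :=
    (continuous_expo j).comp (continuous_const.sub continuous_id)
  simp only [this]
  rw [integral_const_mul, integral_finsetSum]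
  swap
  · exact fun n _ => integrableOn_cube ((hc n).mul hn)
  rw [Finset.sum_congr rfl fun n hn => dirichletKernel_expo
    (freqs_mono (h2.symm ▸ (Finset.mem_Icc.1 hn).1) hj) x]
  have h0 : (m : ℂ) + 1 ≠ 0 := by exact_mod_cast m.succ_ne_zero
  rw [Finset.sum_const, Nat.card_Icc, nsmul_eq_mul]
  have : m + m + 1 - m = m + 1 := by omega
  rw [this]
  push_cast
  field_simp

lemma vpKernel_trigSpan {d N : ℕ} (hN : Even N) {T : (Fin d → ℝ) → ℂ}
    (hT : T ∈ trigSpan d (N / 2)) (x : Fin d → ℝ) :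
    ∫ y in Set.Icc (-1 : Fin d → ℝ) 1, (vpKernel d N y : ℂ) * T (x - y) = T x := by
  have hK : Continuous (vpKernel d N) := (isTrig_vpKernel d N).contDiff.continuous
  induction hT using Submodule.span_induction with
  | mem T h => obtain ⟨k, hk, rfl⟩ := h; exact vpKernel_expo hN hk x
  | zero => simp
  | add S T hS hT h1 h2 =>
    have := (contDiff_of_mem_trigSpan hS).continuous
    have := (contDiff_of_mem_trigSpan hT).continuous
    simp only [Pi.add_apply, mul_add]
    rw [integral_add (integrableOn_cube (by fun_prop)) (integrableOn_cube (by fun_prop)), h1, h2]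
  | smul c T _ hT =>
    simp only [Pi.smul_apply, smul_eq_mul, mul_left_comm _ c, integral_const_mul, hT]

lemma perExt_circConv {d : ℕ} (K : (Fin d → ℝ) → ℝ) (f : Cube d → ℝ) :
    perExt (circConv K f) = conv K (perExt f) := by
  funext x
  have : ∀ y, perExt f ((wrap x).1 - y) = perExt f (x - y) := fun y =>
    ((isPer_perExt f).sub_right y).wrap x
  simp only [perExt.eq_1 (circConv K f), circConv, conv, this]

/-- The de la Vallée-Poussin kernel reproduces trigonometric polynomials of half the degree. -/
lemma circConv_vpKernel {d N : ℕ} (hN : Even N) {t : Cube d → ℝ} (ht : t ∈ trigPoly d (N / 2))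
    (z : Cube d) : circConv (vpKernel d N) t z = t z := by
  obtain ⟨T, hT, h⟩ := exists_trigSpan_of_mem_trigPoly ht
  have h1 : ∀ x, T x = perExt t x := fun x => by
    rw [← (isPer_of_mem_trigSpan hT).wrap x, h, perExt]
  have h2 := vpKernel_trigSpan hN hT z.1
  rw [h] at h2
  simp only [h1, ← Complex.ofReal_mul] at h2
  rw [integral_complex_ofReal] at h2
  exact Complex.ofReal_injective h2

/-! ### Uniform `L¹` bound for the de la Vallée-Poussin kernels -/

/-- The squared modulus is `(1 - r)² + 4r sin²(πt/2)`, and Jordan's inequality gives `sin(π|t|/2) ≥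
|t|`. -/
lemma le_norm_one_sub_circ {r t : ℝ} (hr : 1 / 2 ≤ r) (ht : |t| ≤ 1) :
    ((1 - r) + |t|) / 2 ≤ ‖1 - r * circ t‖ := by
  have h1 : ‖1 - r * circ t‖ ^ 2 = (1 - r) ^ 2 + 4 * r * Real.sin (Real.pi * t / 2) ^ 2 := by
    have hc : Real.cos (Real.pi * t) = 1 - 2 * Real.sin (Real.pi * t / 2) ^ 2 := by
      rw [← Real.cos_sq_add_sin_sq (Real.pi * t / 2)]
      have := Real.cos_two_mul (Real.pi * t / 2)
      have h2 : 2 * (Real.pi * t / 2) = Real.pi * t := by ring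
      rw [h2] at this
      rw [this]
      nlinarith [Real.cos_sq_add_sin_sq (Real.pi * t / 2)]
    rw [← Complex.normSq_eq_norm_sq, circ_eq, Complex.normSq_apply]
    simp only [Complex.sub_re, Complex.sub_im, Complex.one_re, Complex.one_im, Complex.mul_re,
      Complex.mul_im, Complex.add_re, Complex.add_im, Complex.ofReal_re, Complex.ofReal_im,
      Complex.I_re, Complex.I_im]
    linear_combination (r ^ 2) * Real.cos_sq_add_sin_sq (Real.pi * t) - 2 * r * hc
  have h2 : t ^ 2 ≤ Real.sin (Real.pi * t / 2) ^ 2 := by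
    have h3 := Real.mul_le_sin (x := Real.pi * |t| / 2) (by positivity)
      (by nlinarith [Real.pi_pos])
    have h4 : 2 / Real.pi * (Real.pi * |t| / 2) = |t| := by field_simp
    rw [h4] at h3
    have h5 : Real.sin (Real.pi * |t| / 2) ^ 2 = Real.sin (Real.pi * t / 2) ^ 2 := by
      rcases abs_choice t with h | h <;> rw [h]
      rw [show Real.pi * -t / 2 = -(Real.pi * t / 2) by ring, Real.sin_neg, neg_sq]
    rw [← h5, ← sq_abs t]
    exact pow_le_pow_left₀ (abs_nonneg t) h3 2
  refine le_of_sq_le_sq ?_ (norm_nonneg _)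
  rw [h1]
  nlinarith [sq_nonneg ((1 - r) - |t|), sq_abs t, sq_nonneg (1 - r)]

lemma integral_add_abs_rpow {δ p : ℝ} (hδ : 0 < δ) (hp : 1 < p) :
    ∫ t in (-1 : ℝ)..1, (δ + |t|) ^ (-p) ≤ 2 / (p - 1) * δ ^ (1 - p) := by
  have hc : Continuous fun t : ℝ => (δ + |t|) ^ (-p) :=
    (continuous_const.add continuous_abs).rpow_const fun t =>
      Or.inl (add_pos_of_pos_of_nonneg hδ (abs_nonneg t)).ne'
  have h0 : ∫ t in (-1 : ℝ)..0, (δ + |t|) ^ (-p) = ∫ t in (0 : ℝ)..1, (δ + |t|) ^ (-p) := by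
    have := intervalIntegral.integral_comp_neg (a := 0) (b := 1) fun t : ℝ => (δ + |t|) ^ (-p)
    simp only [abs_neg, neg_zero] at this
    exact this.symm
  have h1 : ∫ t in (0 : ℝ)..1, (δ + |t|) ^ (-p) = ∫ t in (0 : ℝ)..1, (δ + t) ^ (-p) := by
    refine intervalIntegral.integral_congr fun t ht => ?_
    rw [Set.uIcc_of_le zero_le_one] at ht
    simp only [abs_of_nonneg ht.1]
  have h2 : ∫ t in (0 : ℝ)..1, (δ + t) ^ (-p) ≤ 1 / (p - 1) * δ ^ (1 - p) := by
    rw [intervalIntegral.integral_comp_add_left (fun t : ℝ => t ^ (-p)) δ, add_zero,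
      integral_rpow (Or.inr ⟨by linarith, by
        rw [Set.uIcc_of_le (by linarith)]
        exact fun h => absurd h.1 (not_le.2 hδ)⟩)]
    have h3 : 0 ≤ (δ + 1) ^ (1 - p) := by positivity
    have h4 : -p + 1 = -(p - 1) := by ring
    have h5 : -(p - 1) = 1 - p := by ring
    rw [h4, div_neg, ← neg_div, h5, one_div_mul_eq_div]
    gcongr
    linarith
  rw [← intervalIntegral.integral_add_adjacent_intervals (b := 0)
    (hc.intervalIntegrable _ _) (hc.intervalIntegrable _ _), h0, h1]
  calc _ ≤ 1 / (p - 1) * δ ^ (1 - p) + 1 / (p - 1) * δ ^ (1 - p) := add_le_add h2 h2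
    _ = _ := by ring

lemma one_sub_ne_zero {z : ℂ} (hz : ‖z‖ < 1) : 1 - z ≠ 0 := by
  intro h
  rw [← sub_eq_zero.1 h, norm_one] at hz
  exact lt_irrefl _ hz

lemma norm_mul_circ {r : ℝ} (hr : 0 ≤ r) (t : ℝ) : ‖(r : ℂ) * circ t‖ = r := by
  rw [norm_mul, norm_circ, mul_one, Complex.norm_real, Real.norm_of_nonneg hr]

lemma continuous_norm_rpow {r : ℝ} (hr : 0 ≤ r) (hr1 : r < 1) (p : ℝ) :
    Continuous fun t : ℝ => ‖1 - r * circ t‖ ^ p := by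
  refine Continuous.rpow_const (by fun_prop) fun t => Or.inl ?_
  exact norm_ne_zero_iff.2 (one_sub_ne_zero (by rwa [norm_mul_circ hr]))

/-- Periodicity removes the shift `s`; what remains is compared with a power of `(1 - r) + |t|`. -/
lemma integral_norm_one_sub_rpow {r p : ℝ} (hr : 1 / 2 ≤ r) (hr1 : r < 1) (hp : 1 < p) (s : ℝ) :
    ∫ t in (-1 : ℝ)..1, ‖1 - r * circ (s + t)‖ ^ (-p)
      ≤ 2 ^ p * (2 / (p - 1)) * (1 - r) ^ (1 - p) := by
  have hδ : 0 < 1 - r := by linarith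
  have hc := continuous_norm_rpow (by linarith) hr1 (-p)
  have hper : Function.Periodic (fun t : ℝ => ‖1 - r * circ t‖ ^ (-p)) 2 := fun t => by
    have := circ_two_int 1
    simp only [circ_add]
    rw [show (2 : ℝ) = 2 * (1 : ℤ) by norm_num, this, mul_one]
  have h0 : ∫ t in (-1 : ℝ)..1, ‖1 - r * circ (s + t)‖ ^ (-p)
      = ∫ t in (-1 : ℝ)..1, ‖1 - r * circ t‖ ^ (-p) := by
    rw [intervalIntegral.integral_comp_add_left (fun t : ℝ => ‖1 - r * circ t‖ ^ (-p)) s]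
    have := hper.intervalIntegral_add_eq (s + -1) (-1)
    rwa [show s + -1 + 2 = s + 1 by ring, show (-1 : ℝ) + 2 = 1 by norm_num] at this
  rw [h0]
  calc ∫ t in (-1 : ℝ)..1, ‖1 - r * circ t‖ ^ (-p)
      ≤ ∫ t in (-1 : ℝ)..1, 2 ^ p * ((1 - r) + |t|) ^ (-p) := by
        refine intervalIntegral.integral_mono_on (by norm_num) (hc.intervalIntegrable _ _)
          (Continuous.intervalIntegrable ?_ _ _) fun t ht => ?_
        · exact continuous_const.mul ((continuous_const.add continuous_abs).rpow_const fun t =>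
            Or.inl (add_pos_of_pos_of_nonneg hδ (abs_nonneg t)).ne')
        · have h1 : 0 < ((1 - r) + |t|) / 2 := by
            have := abs_nonneg t
            linarith
          have h2 := Real.rpow_le_rpow_of_nonpos h1
            (le_norm_one_sub_circ hr (abs_le.2 ht)) (by linarith : -p ≤ 0)
          refine h2.trans (le_of_eq ?_)
          rw [Real.div_rpow (by linarith) (by norm_num), Real.rpow_neg zero_le_two]
          field_simp
    _ = 2 ^ p * ∫ t in (-1 : ℝ)..1, ((1 - r) + |t|) ^ (-p) :=
        intervalIntegral.integral_const_mul _ _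
    _ ≤ 2 ^ p * (2 / (p - 1) * (1 - r) ^ (1 - p)) := by
        gcongr
        exact integral_add_abs_rpow hδ hp
    _ = _ := by ring

/-- `∑_{k ∈ ℤ} z^{|k|} e^{iπky}` in closed form. -/
def poisson (z : ℂ) (y : ℝ) : ℂ := (1 - z * circ y)⁻¹ + (1 - z * circ (-y))⁻¹ - 1

/-- `∑_{|k| ≤ L} z^{|k|} e^{iπky}`. -/
def poissonSum (L : ℕ) (z : ℂ) (y : ℝ) : ℂ :=
  ∑ k ∈ Finset.Icc (-(L : ℤ)) L, z ^ k.natAbs * circ (k * y)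

/-- Since `w / (2b) ≤ 1`, it is at most its own `ε`-th power, and there `2b` may be replaced by `a`.
This trades the larger denominator for a small power of the smaller one. -/
lemma norm_poisson_le_of_le {a b w ε : ℝ} (ha : 0 < a) (hab : a ≤ b) (hw : 0 ≤ w)
    (hwab : w ≤ a + b) (hε : 0 < ε) (hε1 : ε ≤ 1) :
    w / (a * b) ≤ 2 * w ^ ε * a ^ (-(1 + ε)) := by
  have hb : 0 < b := ha.trans_le hab
  have hq0 : 0 ≤ w / (2 * b) := by positivity
  have hq1 : w / (2 * b) ≤ 1 := by rw [div_le_one (by positivity)]; linarith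
  have h1 : w / (2 * b) ≤ (w / (2 * b)) ^ ε := by
    rcases hq0.eq_or_lt with h | h
    · rw [← h, Real.zero_rpow hε.ne']
    · simpa using Real.rpow_le_rpow_of_exponent_ge h hq1 hε1
  have h2 : (w / (2 * b)) ^ ε ≤ (w / a) ^ ε := by
    refine Real.rpow_le_rpow hq0 ?_ hε.le
    gcongr
    linarith
  have h3 : (w / a) ^ ε = w ^ ε * a ^ (-ε) := by
    rw [Real.div_rpow hw ha.le, Real.rpow_neg ha.le, div_eq_mul_inv]
  have h4 : a ^ (-(1 + ε)) = a⁻¹ * a ^ (-ε) := by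
    rw [neg_add, Real.rpow_add ha, Real.rpow_neg_one]
  calc w / (a * b) = 2 * a⁻¹ * (w / (2 * b)) := by field_simp
    _ ≤ 2 * a⁻¹ * (w ^ ε * a ^ (-ε)) := by
        rw [← h3]
        gcongr
        exact h1.trans h2
    _ = _ := by rw [h4]; ring

/-- The kernel equals `(1 - z²)/(AB)`, and `1 - z² = A + z e^{iπy} B` gives `|1 - z²| ≤ |A| + |B|`.
The sum on the right covers both cases of which factor is smaller. -/
lemma norm_poisson_le {z : ℂ} (hz : ‖z‖ < 1) (y : ℝ) {ε : ℝ} (hε : 0 < ε) (hε1 : ε ≤ 1) :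
    ‖poisson z y‖ ≤ 4 * ‖1 - z‖ ^ ε *
      (‖1 - z * circ y‖ ^ (-(1 + ε)) + ‖1 - z * circ (-y)‖ ^ (-(1 + ε))) := by
  set A := 1 - z * circ y with hA
  set B := 1 - z * circ (-y) with hB
  have hA0 : A ≠ 0 := one_sub_ne_zero (by rwa [norm_mul, norm_circ, mul_one])
  have hB0 : B ≠ 0 := one_sub_ne_zero (by rwa [norm_mul, norm_circ, mul_one])
  have hcc : circ y * circ (-y) = 1 := by rw [← circ_add, add_neg_cancel, circ_zero]
  have h1 : poisson z y = (1 - z ^ 2) / (A * B) := by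
    rw [poisson, ← hA, ← hB]
    field_simp
    rw [hA, hB]
    linear_combination (-z ^ 2) * hcc
  have h2 : ‖1 - z ^ 2‖ ≤ ‖A‖ + ‖B‖ := by
    have : 1 - z ^ 2 = A + z * circ y * B := by
      rw [hA, hB]
      linear_combination (z ^ 2) * hcc
    rw [this]
    refine (norm_add_le _ _).trans (add_le_add le_rfl ?_)
    rw [norm_mul, norm_mul, norm_circ, mul_one]
    exact mul_le_of_le_one_left (norm_nonneg _) hz.le
  have h3 : ‖1 - z ^ 2‖ ^ ε ≤ 2 * ‖1 - z‖ ^ ε := by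
    have h4 : ‖1 - z ^ 2‖ ≤ 2 * ‖1 - z‖ := by
      rw [show 1 - z ^ 2 = (1 + z) * (1 - z) by ring, norm_mul]
      gcongr
      refine (norm_add_le _ _).trans ?_
      rw [norm_one]
      linarith
    refine (Real.rpow_le_rpow (norm_nonneg _) h4 hε.le).trans ?_
    rw [Real.mul_rpow zero_le_two (norm_nonneg _)]
    gcongr
    simpa using Real.rpow_le_rpow_of_exponent_le one_le_two hε1
  have hApos := norm_pos_iff.2 hA0
  have hBpos := norm_pos_iff.2 hB0
  have hpA : 0 ≤ ‖A‖ ^ (-(1 + ε)) := by positivity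
  have hpB : 0 ≤ ‖B‖ ^ (-(1 + ε)) := by positivity
  have hmain : ‖1 - z ^ 2‖ / (‖A‖ * ‖B‖) ≤
      2 * ‖1 - z ^ 2‖ ^ ε * (‖A‖ ^ (-(1 + ε)) + ‖B‖ ^ (-(1 + ε))) := by
    have hw : 0 ≤ 2 * ‖1 - z ^ 2‖ ^ ε := by positivity
    rcases le_total ‖A‖ ‖B‖ with h | h
    · refine (norm_poisson_le_of_le hApos h (norm_nonneg _) h2 hε hε1).trans ?_
      gcongr
      linarith
    · rw [mul_comm ‖A‖]
      refine (norm_poisson_le_of_le hBpos h (norm_nonneg _) (by linarith) hε hε1).trans ?_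
      gcongr
      linarith
  rw [h1, norm_div, norm_mul]
  refine hmain.trans (mul_le_mul_of_nonneg_right ?_ (add_nonneg hpA hpB))
  linarith

lemma continuous_poisson_comp {X : Type*} [TopologicalSpace X] {r : ℝ} (hr : 0 ≤ r) (hr1 : r < 1)
    {f g : X → ℝ} (hf : Continuous f) (hg : Continuous g) :
    Continuous fun x => poisson (r * circ (f x)) (g x) := by
  unfold poisson
  have h : ∀ s t : ℝ, 1 - (r * circ s) * circ t ≠ 0 := fun s t =>
    one_sub_ne_zero (by rwa [norm_mul, norm_circ, mul_one, norm_mul_circ hr])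
  exact (((by fun_prop : Continuous fun x => 1 - (r * circ (f x)) * circ (g x)).inv₀
    fun q => h _ _).add ((by fun_prop : Continuous fun x =>
      1 - (r * circ (f x)) * circ (-g x)).inv₀ fun q => h _ _)).sub continuous_const

lemma continuous_poisson {r : ℝ} (hr : 0 ≤ r) (hr1 : r < 1) :
    Continuous fun q : ℝ × ℝ => poisson (r * circ q.1) q.2 :=
  continuous_poisson_comp hr hr1 continuous_fst continuous_snd

/-- The `L¹` norm of the complex Poisson kernel. -/
lemma integral_norm_poisson {r ε : ℝ} (hr : 1 / 2 ≤ r) (hr1 : r < 1) (hε : 0 < ε) (hε1 : ε ≤ 1)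
    (s : ℝ) : ∫ y in (-1 : ℝ)..1, ‖poisson (r * circ s) y‖ ≤
      (8 * (2 ^ (1 + ε) * (2 / ε))) * (‖1 - r * circ s‖ / (1 - r)) ^ ε := by
  have hr0 : 0 ≤ r := by linarith
  have hδ : 0 < 1 - r := by linarith
  have hz : ‖(r : ℂ) * circ s‖ < 1 := by rwa [norm_mul_circ hr0]
  set w := ‖1 - (r : ℂ) * circ s‖
  have hc := continuous_norm_rpow hr0 hr1 (-(1 + ε))
  have hc1 : Continuous fun y : ℝ => ‖1 - r * circ (s + y)‖ ^ (-(1 + ε)) :=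
    hc.comp (continuous_const.add continuous_id)
  have hc2 : Continuous fun y : ℝ => ‖1 - r * circ (s + -y)‖ ^ (-(1 + ε)) :=
    hc.comp (continuous_const.add continuous_neg)
  have h1 := integral_norm_one_sub_rpow hr hr1 (by linarith : 1 < 1 + ε) s
  have h2 : ∫ y in (-1 : ℝ)..1, ‖1 - r * circ (s + -y)‖ ^ (-(1 + ε))
      = ∫ y in (-1 : ℝ)..1, ‖1 - r * circ (s + y)‖ ^ (-(1 + ε)) := by
    have := intervalIntegral.integral_comp_neg (a := -1) (b := 1)
      fun y : ℝ => ‖1 - r * circ (s + y)‖ ^ (-(1 + ε))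
    simpa only [neg_neg] using this
  calc ∫ y in (-1 : ℝ)..1, ‖poisson (r * circ s) y‖
      ≤ ∫ y in (-1 : ℝ)..1, 4 * w ^ ε * (‖1 - r * circ (s + y)‖ ^ (-(1 + ε))
          + ‖1 - r * circ (s + -y)‖ ^ (-(1 + ε))) := by
        refine intervalIntegral.integral_mono_on (by norm_num)
          (Continuous.intervalIntegrable ?_ _ _)
          ((continuous_const.mul (hc1.add hc2)).intervalIntegrable _ _) fun y _ => ?_
        · exact (continuous_poisson_comp hr0 hr1 continuous_const continuous_id).norm
        · have := norm_poisson_le hz y hε hε1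
          simpa only [circ_add, mul_assoc] using this
    _ = 8 * w ^ ε * ∫ y in (-1 : ℝ)..1, ‖1 - r * circ (s + y)‖ ^ (-(1 + ε)) := by
        rw [intervalIntegral.integral_const_mul, intervalIntegral.integral_add
          (hc1.intervalIntegrable _ _) (hc2.intervalIntegrable _ _), h2]
        ring
    _ ≤ 8 * w ^ ε * (2 ^ (1 + ε) * (2 / (1 + ε - 1)) * (1 - r) ^ (1 - (1 + ε))) := by
        gcongr
    _ = _ := by
        rw [Real.div_rpow (norm_nonneg _) hδ.le, show 1 - (1 + ε) = -ε by ring,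
          Real.rpow_neg hδ.le, show 1 + ε - 1 = ε by ring]
        ring

lemma poissonSum_eq (L : ℕ) (z : ℂ) (y : ℝ) : poissonSum L z y =
    ∑ j ∈ Finset.range (L + 1), (z * circ y) ^ j +
      ∑ j ∈ Finset.range (L + 1), (z * circ (-y)) ^ j - 1 := by
  induction L with
  | zero => simp [poissonSum]
  | succ L ih =>
    have h : Finset.Icc (-((L + 1 : ℕ) : ℤ)) ((L + 1 : ℕ) : ℤ) =
        insert (-((L + 1 : ℕ) : ℤ)) (insert ((L + 1 : ℕ) : ℤ) (Finset.Icc (-(L : ℤ)) L)) := by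
      ext k
      simp only [Finset.mem_Icc, Finset.mem_insert]
      omega
    rw [Finset.sum_range_succ, Finset.sum_range_succ _ (L + 1)]
    have e : poissonSum (L + 1) z y = z ^ (L + 1) * circ (-y) ^ (L + 1) +
        (z ^ (L + 1) * circ y ^ (L + 1) + poissonSum L z y) := by
      rw [poissonSum, h, Finset.sum_insert, Finset.sum_insert, ← poissonSum,
        Int.natAbs_neg, Int.natAbs_natCast, ← circ_nat_mul (L + 1) y, Int.cast_natCast]
      · congr 2
        rw [← circ_nat_mul]
        congr 1; push_cast; ring
      · simp
      · simp only [Finset.mem_Icc, Finset.mem_insert]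
        omega
    rw [e, ih, mul_pow, mul_pow]
    ring

lemma tendsto_poissonSum {z : ℂ} (hz : ‖z‖ < 1) (y : ℝ) :
    Filter.Tendsto (fun L => poissonSum L z y) Filter.atTop (nhds (poisson z y)) := by
  simp only [poissonSum_eq]
  have h : ∀ t : ℝ, Filter.Tendsto (fun L => ∑ j ∈ Finset.range (L + 1), (z * circ t) ^ j)
      Filter.atTop (nhds (1 - z * circ t)⁻¹) := fun t =>
    ((hasSum_geometric_of_norm_lt_one (by rwa [norm_mul, norm_circ, mul_one])).tendsto_sum_nat).comp
      (Filter.tendsto_add_atTop_nat 1)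
  exact ((h y).add (h (-y))).sub tendsto_const_nhds

lemma norm_poissonSum_le {z : ℂ} (hz : ‖z‖ < 1) (L : ℕ) (y : ℝ) :
    ‖poissonSum L z y‖ ≤ 2 * (1 - ‖z‖)⁻¹ + 1 := by
  rw [poissonSum_eq]
  have h : ∀ t : ℝ, ‖∑ j ∈ Finset.range (L + 1), (z * circ t) ^ j‖ ≤ (1 - ‖z‖)⁻¹ := fun t => by
    refine (norm_sum_le _ _).trans ?_
    simp only [norm_pow, norm_mul, norm_circ, mul_one]
    rw [← tsum_geometric_of_lt_one (norm_nonneg z) hz]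
    exact (summable_geometric_of_lt_one (norm_nonneg z) hz).sum_le_tsum _
      fun j _ => pow_nonneg (norm_nonneg z) j
  calc _ ≤ _ := norm_sub_le _ _
    _ ≤ _ := add_le_add (norm_add_le _ _) norm_one.le
    _ ≤ _ := by linarith [h y, h (-y)]

/-- The Laurent polynomial in `z⁻¹` with coefficient `#{n ∈ [m, 2m] : |k| ≤ n}` at `z^k`. -/
def trapezoid (m : ℕ) (z : ℂ) : ℂ :=
  z ^ (2 * m) * (∑ i ∈ Finset.range (m + 1), z⁻¹ ^ i) * ∑ j ∈ Finset.range (3 * m + 1), z⁻¹ ^ j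

lemma integral_zpow_circ {r : ℝ} (n : ℤ) :
    ∫ t in (-1 : ℝ)..1, ((r : ℂ) * circ t) ^ n = if n = 0 then 2 else 0 := by
  simp only [mul_zpow, ← circ_int_mul]
  rw [intervalIntegral.integral_const_mul, integral_circ]
  split_ifs with h <;> simp [h]

lemma continuous_zpow_circ {r : ℝ} (hr : 0 < r) (n : ℤ) :
    Continuous fun t : ℝ => ((r : ℂ) * circ t) ^ n :=
  Continuous.zpow₀ (by fun_prop) n fun t =>
    Or.inl (mul_ne_zero (by exact_mod_cast hr.ne') (circ_ne_zero t))

/-- For each `i` the exponent vanishes for a single `j`, namely `2m + κ - i`. It lies in the range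
`j ≤ 3m` exactly when `κ ≤ m + i`, and `n = m + i` runs through `[m, 2m]`. -/
lemma integral_trapezoid {r : ℝ} (hr : 0 < r) (m κ : ℕ) :
    ∫ t in (-1 : ℝ)..1, trapezoid m (r * circ t) * (r * circ t) ^ κ
      = 2 * ∑ n ∈ Finset.Icc m (2 * m), if κ ≤ n then 1 else 0 := by
  have h : ∀ t, trapezoid m (r * circ t) * (r * circ t) ^ κ = ∑ i ∈ Finset.range (m + 1),
      ∑ j ∈ Finset.range (3 * m + 1), ((r : ℂ) * circ t) ^ ((2 * m + κ : ℤ) - i - j) := fun t => by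
    have hz : (r : ℂ) * circ t ≠ 0 := mul_ne_zero (by exact_mod_cast hr.ne') (circ_ne_zero t)
    rw [trapezoid, mul_assoc (_ ^ _), Finset.sum_mul_sum, Finset.mul_sum, Finset.sum_mul]
    refine Finset.sum_congr rfl fun i _ => ?_
    rw [Finset.mul_sum, Finset.sum_mul]
    refine Finset.sum_congr rfl fun j _ => ?_
    rw [zpow_sub₀ hz, zpow_sub₀ hz, zpow_add₀ hz, zpow_natCast, zpow_natCast, zpow_natCast,
      inv_pow, inv_pow]
    have : ((r : ℂ) * circ t) ^ (2 * (m : ℤ)) = ((r : ℂ) * circ t) ^ (2 * m) := by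
      rw [← zpow_natCast]; push_cast; rfl
    rw [this]
    field_simp
  simp only [h]
  rw [intervalIntegral.integral_finsetSum]
  swap
  · exact fun i _ => (continuous_finsetSum _ fun j _ =>
      continuous_zpow_circ hr _).intervalIntegrable _ _
  have h2 : ∀ i ∈ Finset.range (m + 1), ∫ t in (-1 : ℝ)..1, ∑ j ∈ Finset.range (3 * m + 1),
      ((r : ℂ) * circ t) ^ ((2 * m + κ : ℤ) - i - j) = 2 * if κ ≤ m + i then 1 else 0 := by
    intro i hi
    have hi' := Finset.mem_range.1 hi
    rw [intervalIntegral.integral_finsetSum fun j _ =>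
      (continuous_zpow_circ hr _).intervalIntegrable _ _]
    simp only [integral_zpow_circ]
    have : ∀ j : ℕ, ((2 * m + κ : ℤ) - i - j = 0) ↔ (2 * m + κ - i = j) := fun j => by omega
    simp only [this, Finset.sum_ite_eq, Finset.mem_range]
    by_cases hκ : κ ≤ m + i
    · rw [if_pos (by omega), if_pos hκ, mul_one]
    · rw [if_neg (by omega), if_neg hκ, mul_zero]
  rw [Finset.sum_congr rfl h2, ← Finset.mul_sum]
  congr 1
  have h3 : Finset.Icc m (2 * m) = Finset.Ico m (m + m + 1) := by
    ext; simp only [Finset.mem_Icc, Finset.mem_Ico]; omega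
  rw [h3, Finset.sum_Ico_eq_sum_range]
  have : m + m + 1 - m = m + 1 := by omega
  rw [this]

lemma continuous_poissonSum (L : ℕ) (r y : ℝ) :
    Continuous fun t : ℝ => poissonSum L (r * circ t) y := by
  unfold poissonSum
  fun_prop

lemma continuous_trapezoid {r : ℝ} (hr : 0 < r) (m : ℕ) :
    Continuous fun t : ℝ => trapezoid m (r * circ t) := by
  unfold trapezoid
  have : Continuous fun t : ℝ => ((r : ℂ) * circ t)⁻¹ := Continuous.inv₀ (by fun_prop) fun t =>
    mul_ne_zero (by exact_mod_cast hr.ne') (circ_ne_zero t)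
  fun_prop

/-- The power of `z` attached to a frequency `k` is its `ℓ¹` norm, so the weight selects `ℓ¹` balls.
With `2 * m ≤ L` no frequency of these balls is lost by truncation. -/
lemma integral_trapezoid_poissonSum {d : ℕ} {r : ℝ} (hr : 0 < r) {m L : ℕ} (hL : 2 * m ≤ L)
    (y : Fin d → ℝ) :
    ∫ t in (-1 : ℝ)..1, trapezoid m (r * circ t) * ∏ i, poissonSum L (r * circ t) (y i)
      = 2 * ∑ n ∈ Finset.Icc m (2 * m), ∑ k ∈ freqs d n, expo k y := by
  set F : Finset (Fin d → ℤ) := Fintype.piFinset fun _ => Finset.Icc (-(L : ℤ)) L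
  have h1 : ∀ t : ℝ, trapezoid m (r * circ t) * ∏ i, poissonSum L (r * circ t) (y i) =
      ∑ k ∈ F, (trapezoid m (r * circ t) * (r * circ t) ^ (∑ i, (k i).natAbs)) * expo k y :=
    fun t => by
      simp only [poissonSum, Finset.prod_univ_sum, Finset.mul_sum]
      refine Finset.sum_congr rfl fun k _ => ?_
      rw [Finset.prod_mul_distrib, Finset.prod_pow_eq_pow_sum, expo, mul_assoc]
  have hc : ∀ κ : ℕ, Continuous fun t : ℝ => trapezoid m (r * circ t) * (r * circ t) ^ κ :=
    fun κ => (continuous_trapezoid hr m).mul (by fun_prop)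
  simp only [h1]
  rw [intervalIntegral.integral_finsetSum]
  swap
  · exact fun k _ => ((hc _).mul continuous_const).intervalIntegrable _ _
  simp only [intervalIntegral.integral_mul_const, integral_trapezoid hr]
  simp only [Finset.mul_sum, Finset.sum_mul]
  rw [Finset.sum_comm]
  refine Finset.sum_congr rfl fun n hn => ?_
  rw [Finset.mem_Icc] at hn
  have h2 : freqs d n = F.filter fun k => ∑ i, (k i).natAbs ≤ n := by
    ext k
    have h3 : ∑ i, |k i| = ((∑ i, (k i).natAbs : ℕ) : ℤ) := by
      push_cast
      exact Finset.sum_congr rfl fun i _ => rfl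
    rw [mem_freqs, h3, Finset.mem_filter, Nat.cast_le, iff_and_self]
    intro h
    refine Fintype.mem_piFinset.2 fun i => Finset.mem_Icc.2 ?_
    have := Finset.single_le_sum (f := fun i => (k i).natAbs) (fun j _ => Nat.zero_le _)
      (Finset.mem_univ i)
    omega
  rw [h2, Finset.sum_filter]
  refine Finset.sum_congr rfl fun k _ => ?_
  split_ifs <;> simp

/-- The truncated integrals are constant once `L ≥ 2m`, and dominated convergence identifies their
limit. -/
lemma integral_trapezoid_poisson {d : ℕ} {r : ℝ} (hr : 0 < r) (hr1 : r < 1) (m : ℕ)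
    (y : Fin d → ℝ) :
    ∫ t in (-1 : ℝ)..1, trapezoid m (r * circ t) * ∏ i, poisson (r * circ t) (y i)
      = 2 * ∑ n ∈ Finset.Icc m (2 * m), ∑ k ∈ freqs d n, expo k y := by
  have hz : ∀ t, ‖(r : ℂ) * circ t‖ < 1 := fun t => by rwa [norm_mul_circ hr.le]
  have hlim : Filter.Tendsto (fun L => ∫ t in (-1 : ℝ)..1, trapezoid m (r * circ t) *
      ∏ i, poissonSum L (r * circ t) (y i)) Filter.atTop (nhds (∫ t in (-1 : ℝ)..1,
        trapezoid m (r * circ t) * ∏ i, poisson (r * circ t) (y i))) := by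
    refine intervalIntegral.tendsto_integral_filter_of_dominated_convergence
      (fun t => ‖trapezoid m (r * circ t)‖ * (2 * (1 - r)⁻¹ + 1) ^ d) ?_ ?_ ?_ ?_
    · exact .of_forall fun L => ((continuous_trapezoid hr m).mul
        (continuous_finsetProd _ fun i _ => continuous_poissonSum L r (y i))).aestronglyMeasurable
    · refine .of_forall fun L => .of_forall fun t _ => ?_
      rw [norm_mul, norm_prod]
      gcongr
      refine (Finset.prod_le_prod (fun i _ => norm_nonneg _)
        fun i _ => norm_poissonSum_le (hz t) L (y i)).trans (le_of_eq ?_)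
      rw [norm_mul_circ hr.le]
      simp
    · exact ((continuous_trapezoid hr m).norm.mul continuous_const).intervalIntegrable _ _
    · exact .of_forall fun t _ => (tendsto_finsetProd _ fun i _ =>
        tendsto_poissonSum (hz t) (y i)).const_mul _
  refine tendsto_nhds_unique hlim (tendsto_const_nhds.congr' ?_)
  filter_upwards [Filter.eventually_ge_atTop (2 * m)] with L hL
  exact (integral_trapezoid_poissonSum hr hL y).symm

/-- At this radius `r^{-a} ≤ e` for all `a ≤ 3m + 1`, so either geometric sum is at most `4 / |1 -
z|`. -/
lemma norm_trapezoid_le (m : ℕ) (t : ℝ) :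
    ‖trapezoid m ((1 - 1 / (3 * m + 2) : ℝ) * circ t)‖ ≤
      16 * ‖1 - ((1 - 1 / (3 * m + 2) : ℝ) : ℂ) * circ t‖ ^ (-2 : ℝ) := by
  set r : ℝ := 1 - 1 / (3 * m + 2) with hr
  have hm : (0 : ℝ) ≤ m := m.cast_nonneg
  have hr2 : r = (3 * m + 1) / (3 * m + 2) := by rw [hr]; field_simp; ring
  have hr0 : 0 < r := by rw [hr2]; positivity
  have hr1 : r < 1 := by rw [hr]; linarith [show 0 < 1 / (3 * (m : ℝ) + 2) by positivity]
  set z := (r : ℂ) * circ t with hz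
  have hzn : ‖z‖ = r := norm_mul_circ hr0.le t
  have hz0 : z ≠ 0 := norm_pos_iff.1 (hzn ▸ hr0)
  have hz1 : 1 - z ≠ 0 := one_sub_ne_zero (hzn ▸ hr1)
  have hw1 : z⁻¹ ≠ 1 := fun h => hz1 (by rw [inv_eq_one.1 h, sub_self])
  have hexp : ∀ a : ℕ, a ≤ 3 * m + 1 → r⁻¹ ^ a ≤ 3 := fun a ha => by
    have h1 : r⁻¹ = 1 + 1 / (3 * m + 1) := by
      rw [hr2]; field_simp; ring
    have h2 : r⁻¹ ≤ Real.exp (1 / (3 * m + 1)) := by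
      rw [h1, add_comm]; exact Real.add_one_le_exp _
    have h3 : 1 ≤ r⁻¹ := by rw [h1]; linarith [show 0 < 1 / (3 * (m : ℝ) + 1) by positivity]
    calc r⁻¹ ^ a ≤ r⁻¹ ^ (3 * m + 1) := pow_le_pow_right₀ h3 ha
      _ ≤ Real.exp (1 / (3 * m + 1)) ^ (3 * m + 1) := pow_le_pow_left₀ (by positivity) h2 _
      _ = Real.exp 1 := by
        rw [← Real.exp_nat_mul]
        congr 1
        push_cast
        field_simp
      _ ≤ 3 := Real.exp_one_lt_three.le
  have hgeom : ∀ a : ℕ, a ≤ 3 * m + 1 →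
      ‖∑ i ∈ Finset.range a, z⁻¹ ^ i‖ ≤ 4 * ‖1 - z‖⁻¹ := fun a ha => by
    rw [geom_sum_eq hw1, norm_div, div_eq_mul_inv]
    have h1 : ‖z⁻¹ ^ a - 1‖ ≤ 4 := by
      refine (norm_sub_le _ _).trans ?_
      rw [norm_pow, norm_inv, hzn, norm_one]
      linarith [hexp a ha]
    have h2 : ‖1 - z‖ ≤ ‖z⁻¹ - 1‖ := by
      have : z⁻¹ - 1 = z⁻¹ * (1 - z) := by field_simp
      rw [this, norm_mul, norm_inv, hzn]
      exact le_mul_of_one_le_left (norm_nonneg _) ((one_le_inv₀ hr0).2 hr1.le)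
    gcongr
  have hneg : ‖1 - z‖ ^ (-2 : ℝ) = ‖1 - z‖⁻¹ * ‖1 - z‖⁻¹ := by
    rw [Real.rpow_neg (norm_nonneg _), ← mul_inv, ← sq]
    norm_cast
  rw [trapezoid, norm_mul, norm_mul, norm_pow, hzn, hneg]
  calc r ^ (2 * m) * ‖∑ i ∈ Finset.range (m + 1), z⁻¹ ^ i‖ *
        ‖∑ i ∈ Finset.range (3 * m + 1), z⁻¹ ^ i‖
      ≤ 1 * (4 * ‖1 - z‖⁻¹) * (4 * ‖1 - z‖⁻¹) := by
        gcongr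
        · exact pow_le_one₀ hr0.le hr1.le
        · exact hgeom _ (by omega)
        · exact hgeom _ le_rfl
    _ = _ := by ring

lemma vpKernel_le (d m : ℕ) {r : ℝ} (hr : 0 < r) (hr1 : r < 1) (y : Fin d → ℝ) :
    |vpKernel d (m + m) y| ≤ ((m : ℝ) + 1)⁻¹ * ∫ t in Set.Icc (-1 : ℝ) 1,
      ‖trapezoid m (r * circ t)‖ * ∏ i, ‖poisson (r * circ t) (y i)‖ := by
  have h2 : (m + m) / 2 = m := by omega
  have h3 : m + m = 2 * m := by omega
  have h1 : (vpKernel d (m + m) y : ℂ) = ((m : ℂ) + 1)⁻¹ * ((1 / 2 : ℂ) ^ d * (1 / 2 *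
      ∫ t in (-1 : ℝ)..1, trapezoid m (r * circ t) * ∏ i, poisson (r * circ t) (y i))) := by
    rw [integral_trapezoid_poisson hr hr1, vpKernel, h2, ← h3]
    push_cast
    simp only [dirichletKernel_eq, ← Finset.mul_sum]
    have : ((m : ℂ) + m) / 2 = m := by ring
    rw [this]; ring
  have h4 : ‖((m : ℂ) + 1)⁻¹‖ = ((m : ℝ) + 1)⁻¹ := by
    rw [norm_inv]
    norm_cast
  rw [← Real.norm_eq_abs, ← Complex.norm_real, h1, norm_mul, h4, ← mul_assoc, norm_mul]
  gcongr
  have h5 : ‖(1 / 2 : ℂ) ^ d * (1 / 2)‖ ≤ 1 := by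
    rw [← pow_succ, norm_pow]
    exact pow_le_one₀ (norm_nonneg _) (by norm_num)
  refine (mul_le_of_le_one_left (norm_nonneg _) h5).trans ?_
  rw [integral_Icc_eq_integral_Ioc, ← intervalIntegral.integral_of_le (by norm_num)]
  refine (intervalIntegral.norm_integral_le_integral_norm (by norm_num)).trans (le_of_eq ?_)
  simp only [norm_mul, norm_prod]

lemma continuous_trapezoid_poisson {r : ℝ} (hr : 0 < r) (hr1 : r < 1) (d m : ℕ) :
    Continuous fun q : (Fin d → ℝ) × ℝ =>
      ‖trapezoid m (r * circ q.2)‖ * ∏ i, ‖poisson (r * circ q.2) (q.1 i)‖ := by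
  have h1 : Continuous fun q : (Fin d → ℝ) × ℝ => trapezoid m (r * circ q.2) :=
    (continuous_trapezoid hr m).comp continuous_snd
  have h2 : ∀ i, Continuous fun q : (Fin d → ℝ) × ℝ => poisson (r * circ q.2) (q.1 i) := fun i =>
    continuous_poisson_comp hr.le hr1 continuous_snd (by fun_prop)
  exact h1.norm.mul (continuous_finsetProd _ fun i _ => (h2 i).norm)

/-- After exchanging the integrals, the integrand for fixed `t` is a product over coordinates of the
same function, which yields a `d`-th power. -/
lemma integral_vpKernel_le (d m : ℕ) {r : ℝ} (hr : 0 < r) (hr1 : r < 1) :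
    ∫ y in Set.Icc (-1 : Fin d → ℝ) 1, |vpKernel d (m + m) y| ≤
      ((m : ℝ) + 1)⁻¹ * ∫ t in (-1 : ℝ)..1, ‖trapezoid m (r * circ t)‖ *
        (∫ s in (-1 : ℝ)..1, ‖poisson (r * circ t) s‖) ^ d := by
  have hi : Integrable (Function.uncurry fun (y : Fin d → ℝ) (t : ℝ) =>
      ‖trapezoid m (r * circ t)‖ * ∏ i, ‖poisson (r * circ t) (y i)‖)
      (((volume : Measure (Fin d → ℝ)).restrict (Set.Icc (-1) 1)).prod
        ((volume : Measure ℝ).restrict (Set.Icc (-1) 1))) := by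
    rw [Measure.prod_restrict]
    exact (continuous_trapezoid_poisson hr hr1 d m).continuousOn.integrableOn_compact
      (isCompact_Icc.prod isCompact_Icc)
  have hvp : Continuous (vpKernel d (m + m)) := (isTrig_vpKernel d (m + m)).contDiff.continuous
  refine (integral_mono (integrableOn_cube hvp.abs) (hi.integral_prod_left.const_mul _)
    fun y => vpKernel_le d m hr hr1 y).trans (le_of_eq ?_)
  simp only [Function.uncurry_apply_pair]
  rw [integral_const_mul, integral_integral_swap hi, integral_Icc_eq_integral_Ioc,
    ← intervalIntegral.integral_of_le (by norm_num)]
  congr 2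
  funext t
  rw [integral_const_mul, integral_cube_prod fun _ s => ‖poisson (r * circ t) s‖,
    Finset.prod_const, Finset.card_univ, Fintype.card_fin]

/-- The `L¹` norms of the de la Vallée-Poussin kernels for `ℓ¹` balls are bounded. -/
lemma exists_isVPBound (d : ℕ) : ∃ Λ : ℝ, IsVPBound d Λ := by
  -- With `ε * d ≤ 1/2` the `d` Poisson factors cost at most `(|1 - z|/δ)^{1/2}`. Against the weight
  -- `|1 - z|^{-2}` this leaves the exponent `-3/2`, still below `-1`.
  set ε : ℝ := 1 / (2 * (d + 1)) with hε
  have hε0 : 0 < ε := by positivity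
  have hd : (0 : ℝ) ≤ d := d.cast_nonneg
  have hε1 : ε ≤ 1 := by rw [hε, div_le_one (by positivity)]; linarith
  have hεd : ε * d ≤ 1 / 2 := by
    rw [hε, div_mul_eq_mul_div, div_le_div_iff₀ (by positivity) (by norm_num)]; linarith
  set c : ℝ := 8 * (2 ^ (1 + ε) * (2 / ε))
  have hc0 : 0 ≤ c := by positivity
  set b : ℝ := 2 ^ (3 / 2 : ℝ) * (2 / (3 / 2 - 1))
  have hb0 : 0 ≤ b := by positivity
  refine ⟨3 * (16 * c ^ d * b), fun N hN hev => ?_⟩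
  obtain ⟨m, rfl⟩ := hev
  have hm : (0 : ℝ) ≤ m := m.cast_nonneg
  set δ : ℝ := 1 / (3 * m + 2) with hδ
  have hδ0 : 0 < δ := by positivity
  have hδ2 : δ ≤ 1 / 2 := by
    rw [hδ]
    gcongr
    linarith
  set r : ℝ := 1 - δ with hr
  have hr2 : 1 / 2 ≤ r := by linarith
  have hr0 : 0 < r := by linarith
  have hr1 : r < 1 := by linarith
  have hrδ : 1 - r = δ := by rw [hr]; ring
  set w : ℝ → ℝ := fun t => ‖1 - (r : ℂ) * circ t‖ with hw
  have hw0 : ∀ t, 0 < w t := fun t =>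
    norm_pos_iff.2 (one_sub_ne_zero (by rwa [norm_mul_circ hr0.le]))
  have hwδ : ∀ t, 1 ≤ w t / δ := fun t => by
    rw [one_le_div hδ0, ← hrδ]
    have := norm_sub_norm_le (1 : ℂ) (r * circ t)
    rwa [norm_one, norm_mul_circ hr0.le] at this
  have hwc : Continuous fun t => w t ^ (-(3 / 2) : ℝ) := continuous_norm_rpow hr0.le hr1 _
  have hpc : Continuous fun t : ℝ => ∫ s in (-1 : ℝ)..1, ‖poisson (r * circ t) s‖ :=
    intervalIntegral.continuous_parametric_intervalIntegral_of_continuous'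
      (continuous_poisson hr0.le hr1).norm _ _
  calc ∫ y in Set.Icc (-1 : Fin d → ℝ) 1, |vpKernel d (m + m) y|
      ≤ ((m : ℝ) + 1)⁻¹ * ∫ t in (-1 : ℝ)..1, ‖trapezoid m (r * circ t)‖ *
          (∫ s in (-1 : ℝ)..1, ‖poisson (r * circ t) s‖) ^ d := integral_vpKernel_le d m hr0 hr1
    _ ≤ ((m : ℝ) + 1)⁻¹ * ∫ t in (-1 : ℝ)..1,
          (16 * c ^ d * δ ^ (-(1 / 2) : ℝ)) * w t ^ (-(3 / 2) : ℝ) := by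
        gcongr
        refine intervalIntegral.integral_mono_on (by norm_num)
          (((continuous_trapezoid hr0 m).norm.mul (hpc.pow d)).intervalIntegrable _ _)
          ((continuous_const.mul hwc).intervalIntegrable _ _) fun t _ => ?_
        have h1 : (∫ s in (-1 : ℝ)..1, ‖poisson (r * circ t) s‖) ^ d
            ≤ c ^ d * (w t / δ) ^ (1 / 2 : ℝ) := by
          have h2 := integral_norm_poisson hr2 hr1 hε0 hε1 t
          rw [hrδ] at h2
          refine (pow_le_pow_left₀ (intervalIntegral.integral_nonneg (by norm_num)
            fun s _ => norm_nonneg _) h2 d).trans ?_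
          -- The base `w t / δ` is at least `1`, so its exponent `ε * d` may be raised to `1/2`.
          rw [mul_pow, ← Real.rpow_mul_natCast (by linarith [hwδ t])]
          gcongr
          exact hwδ t
        refine (mul_le_mul (norm_trapezoid_le m t) h1 (pow_nonneg
          (intervalIntegral.integral_nonneg (by norm_num) fun s _ => norm_nonneg _) d)
          (by positivity)).trans (le_of_eq ?_)
        change 16 * w t ^ (-2 : ℝ) * _ = _
        rw [Real.div_rpow (hw0 t).le hδ0.le, Real.rpow_neg hδ0.le,
          show (-(3 / 2) : ℝ) = -2 + 1 / 2 by norm_num, Real.rpow_add (hw0 t)]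
        ring
    _ ≤ ((m : ℝ) + 1)⁻¹ * ((16 * c ^ d * δ ^ (-(1 / 2) : ℝ)) * (b * δ ^ (1 - 3 / 2 : ℝ))) := by
        rw [intervalIntegral.integral_const_mul]
        gcongr
        have := integral_norm_one_sub_rpow hr2 hr1 (by norm_num : (1 : ℝ) < 3 / 2) 0
        simpa only [zero_add, hrδ] using this
    -- The two factors `δ^{-1/2}` make `δ^{-1} = 3m + 2`, which the averaging factor `1/(m + 1)`
    -- absorbs.
    _ = 16 * c ^ d * b * ((3 * m + 2) / (m + 1)) := by
        have : δ ^ (-(1 / 2) : ℝ) * δ ^ (1 - 3 / 2 : ℝ) = 3 * m + 2 := by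
          rw [← Real.rpow_add hδ0, show (-(1 / 2) + (1 - 3 / 2) : ℝ) = -1 by norm_num,
            Real.rpow_neg_one, hδ, one_div, inv_inv]
        rw [← this]
        ring
    _ ≤ 16 * c ^ d * b * 3 := by
        gcongr
        rw [div_le_iff₀ (by positivity)]
        linarith
    _ = _ := by ring

/-! ### From almost everywhere bounds to bounds everywhere -/

/-- A Lipschitz function whose partial derivatives are almost everywhere bounded by `B` is
`B`-Lipschitz for the `ℓ¹` norm. -/
lemma abs_sub_le_of_ae_partialD_le {d : ℕ} {u : (Fin d → ℝ) → ℝ} {L : ℝ≥0}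
    (hu : LipschitzWith L u) {B : ℝ} (hB : ∀ i, ∀ᵐ x, |partialD i u x| ≤ B) (x v : Fin d → ℝ) :
    |u (x + v) - u x| ≤ B * ∑ i, |v i| := by
  set c := B * ∑ i, |v i|
  -- By Rademacher's theorem the directional derivative is almost everywhere the linear combination
  -- of the partial ones.
  have h1 : ∀ᵐ x, |lineDeriv ℝ u x v| ≤ c := by
    filter_upwards [hu.ae_differentiableAt (μ := volume), ae_all_iff.2 hB] with x hx hb
    have h2 : lineDeriv ℝ u x v = ∑ i, v i * partialD i u x := by
      simp only [partialD, hx.lineDeriv_eq_fderiv]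
      conv_lhs => rw [pi_eq_sum_univ' v]
      rw [map_sum]
      refine Finset.sum_congr rfl fun i _ => ?_
      rw [map_smul, smul_eq_mul]
    rw [h2]
    refine (Finset.abs_sum_le_sum_abs _ _).trans ?_
    rw [show c = ∑ i, B * |v i| from Finset.mul_sum _ _ _]
    refine Finset.sum_le_sum fun i _ => ?_
    rw [abs_mul, mul_comm]
    exact mul_le_mul_of_nonneg_right (hb i) (abs_nonneg _)
  obtain ⟨S, hbad, hSm, hS0⟩ := exists_measurable_superset_of_null (ae_iff.1 h1)
  have hgood : ∀ x, x ∉ S → |lineDeriv ℝ u x v| ≤ c := fun x hx => by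
    by_contra h
    exact hx (hbad h)
  -- Fubini: almost every line in direction `v` meets the exceptional set in a null set. On such
  -- lines the fundamental theorem for absolutely continuous functions applies.
  have h3 : ∀ᵐ x : Fin d → ℝ, ∀ᵐ s : ℝ, x + s • v ∉ S := by
    have hm : MeasurableSet {q : ℝ × (Fin d → ℝ) | q.2 + q.1 • v ∉ S} :=
      (hSm.preimage (by fun_prop : Measurable fun q : ℝ × (Fin d → ℝ) => q.2 + q.1 • v)).compl
    refine (Measure.ae_ae_comm (μ := volume) (ν := volume)
      (p := fun (s : ℝ) (x : Fin d → ℝ) => x + s • v ∉ S) hm).1 (.of_forall fun s => ?_)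
    exact (measurePreserving_add_right volume (s • v)).quasiMeasurePreserving.ae
      (measure_eq_zero_iff_ae_notMem.1 hS0)
  have h4 : ∀ᵐ x : Fin d → ℝ, |u (x + v) - u x| ≤ c := by
    filter_upwards [h3] with x hx
    set φ : ℝ → ℝ := fun s => u (x + s • v) with hφ
    have hlip : LipschitzWith (L * ‖v‖₊) φ := by
      refine hu.comp (LipschitzWith.of_dist_le_mul fun s t => ?_)
      rw [dist_add_left, dist_eq_norm, ← sub_smul, norm_smul, mul_comm, dist_eq_norm]
      rfl
    have hac : AbsolutelyContinuousOnInterval φ 0 1 :=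
      hlip.lipschitzOnWith.absolutelyContinuousOnInterval
    have hd : ∀ s, deriv φ s = lineDeriv ℝ u (x + s • v) v := fun s => by
      rw [lineDeriv]
      have h5 : (fun t : ℝ => u (x + s • v + t • v)) = fun t => φ (s + t) := by
        funext t
        simp only [hφ, add_smul, add_assoc]
      rw [h5, deriv_comp_const_add, add_zero]
    have h6 := hac.integral_deriv_eq_sub
    have h7 : φ 1 - φ 0 = u (x + v) - u x := by simp [hφ]
    rw [← h7, ← h6, ← Real.norm_eq_abs]
    refine (intervalIntegral.norm_integral_le_of_norm_le_const_ae (C := c) ?_).trans (by simp)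
    filter_upwards [hx] with s hs _
    rw [hd s, Real.norm_eq_abs]
    exact hgood _ hs
  -- A set of full measure is dense, and the inequality is a closed condition.
  have hcl : IsClosed {x : Fin d → ℝ | |u (x + v) - u x| ≤ c} :=
    isClosed_le (((hu.continuous.comp (continuous_add_const v)).sub hu.continuous).abs)
      continuous_const
  have := (Measure.dense_of_ae h4).closure_eq
  rw [hcl.closure_eq] at this
  exact Set.eq_univ_iff_forall.1 this x

lemma le_of_ae_le {d : ℕ} {u : (Fin d → ℝ) → ℝ} (hu : Continuous u) {B : ℝ}
    (hB : ∀ᵐ x, |u x| ≤ B) (x : Fin d → ℝ) : |u x| ≤ B := by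
  have hcl : IsClosed {x : Fin d → ℝ | |u x| ≤ B} := isClosed_le hu.abs continuous_const
  have := (Measure.dense_of_ae hB).closure_eq
  rw [hcl.closure_eq] at this
  exact Set.eq_univ_iff_forall.1 this x

lemma IsPer.exists_bound {d : ℕ} {g : (Fin d → ℝ) → ℝ} (hg : IsPer g) (hc : Continuous g) :
    ∃ M, ∀ x, |g x| ≤ M := by
  obtain ⟨M, hM⟩ := (isCompact_Icc (a := (-1 : Fin d → ℝ)) (b := 1)).exists_bound_of_continuousOn
    hc.continuousOn
  exact ⟨M, fun x => by rw [← hg.wrap x]; exact hM _ (ProjQ.wrap x).2⟩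

/-! Partial derivatives. -/

lemma partialD_eq_fderiv {d : ℕ} {g : (Fin d → ℝ) → ℝ} (hg : Differentiable ℝ g) (i : Fin d) :
    partialD i g = fun x => fderiv ℝ g x (Pi.single i 1) := by
  funext x
  rw [partialD, (hg x).lineDeriv_eq_fderiv]

lemma contDiff_partialD {d m : ℕ} {g : (Fin d → ℝ) → ℝ} (hg : ContDiff ℝ (m + 1 : ℕ) g)
    (i : Fin d) : ContDiff ℝ m (partialD i g) := by
  rw [partialD_eq_fderiv (hg.differentiable (by simp)) i]
  exact (hg.fderiv_right (m := m) (by norm_cast)).clm_apply contDiff_const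

lemma IsPer.partialD {d : ℕ} {g : (Fin d → ℝ) → ℝ} (hg : IsPer g) (i : Fin d) :
    IsPer (partialD i g) := fun n x => by
  simp only [ProjQ.partialD, lineDeriv]
  congr 1
  funext t
  rw [← hg n (x + t • Pi.single i 1)]
  congr 1
  funext j
  simp only [Pi.add_apply]
  ring

lemma IsPer.mixedD {d : ℕ} {g : (Fin d → ℝ) → ℝ} (hg : IsPer g) (l : List (Fin d)) :
    IsPer (mixedD l g) := by
  induction l with
  | nil => exact hg
  | cons i l ih => exact ih.partialD i

lemma contDiff_mixedD {d m : ℕ} {g : (Fin d → ℝ) → ℝ} (l : List (Fin d))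
    (hg : ContDiff ℝ (m + l.length : ℕ) g) : ContDiff ℝ m (mixedD l g) := by
  induction l generalizing m with
  | nil => exact hg
  | cons i l ih =>
    refine contDiff_partialD (ih ?_) i
    rw [List.length_cons] at hg
    rwa [add_assoc, add_comm 1]

lemma contDiff_mixedD_of_le {d ν : ℕ} {g : (Fin d → ℝ) → ℝ} (hg : ContDiff ℝ ν g)
    {l : List (Fin d)} (hl : l.length ≤ ν) : ContDiff ℝ (ν - l.length : ℕ) (mixedD l g) :=
  contDiff_mixedD l (by rwa [Nat.sub_add_cancel hl])

lemma continuous_mixedD {d ν : ℕ} {g : (Fin d → ℝ) → ℝ} (hg : ContDiff ℝ ν g)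
    {l : List (Fin d)} (hl : l.length ≤ ν) : Continuous (mixedD l g) :=
  (contDiff_mixedD_of_le hg hl).continuous

/-- `mixedD` peels derivatives off from the outside; the induction in `abs_remainder_le` needs the
innermost one. -/
lemma mixedD_append {d : ℕ} (l : List (Fin d)) (i : Fin d) (g : (Fin d → ℝ) → ℝ) :
    mixedD (l ++ [i]) g = mixedD l (partialD i g) := by
  induction l with
  | nil => rfl
  | cons j l ih => simp only [List.cons_append, mixedD, ih]

lemma abs_sub_le_of_partialD_le {d : ℕ} {u : (Fin d → ℝ) → ℝ} (hu : ContDiff ℝ 1 u)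
    {B : ℝ} (hB : ∀ i x, |partialD i u x| ≤ B) (x v : Fin d → ℝ) :
    |u (x + v) - u x| ≤ B * ∑ i, |v i| := by
  have hd : Differentiable ℝ u := hu.differentiable (by simp)
  have h2 : ∀ y w, fderiv ℝ u y w = ∑ i, w i * partialD i u y := fun y w => by
    simp only [partialD_eq_fderiv hd]
    conv_lhs => rw [pi_eq_sum_univ' w]
    rw [map_sum]
    refine Finset.sum_congr rfl fun i _ => ?_
    rw [map_smul, smul_eq_mul]
  have h3 : ∀ t : ℝ, HasDerivAt (fun t : ℝ => u (x + t • v)) (fderiv ℝ u (x + t • v) v) t :=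
    fun t => by
      have h4 : HasDerivAt (fun t : ℝ => x + t • v) v t := by
        simpa using ((hasDerivAt_id t).smul_const v).const_add x
      exact (hd _).hasFDerivAt.comp_hasDerivAt t h4
  have h5 := (convex_univ (𝕜 := ℝ) (E := ℝ)).norm_image_sub_le_of_norm_hasDerivWithin_le
    (f := fun t : ℝ => u (x + t • v)) (C := B * ∑ i, |v i|) (x := 0) (y := 1)
    (fun t _ => (h3 t).hasDerivWithinAt) (fun t _ => by
      rw [h2, Real.norm_eq_abs]
      refine (Finset.abs_sum_le_sum_abs _ _).trans ?_
      rw [Finset.mul_sum]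
      refine Finset.sum_le_sum fun i _ => ?_
      rw [abs_mul, mul_comm]
      exact mul_le_mul_of_nonneg_right (hB i _) (abs_nonneg _)) (Set.mem_univ _) (Set.mem_univ _)
  simpa using h5

/-! Convolution. -/

lemma abs_conv_sub_le {d : ℕ} {K g : (Fin d → ℝ) → ℝ} (hK : Continuous K) (hg : Continuous g)
    {x x' : Fin d → ℝ} {c : ℝ} (h : ∀ y, |g (x - y) - g (x' - y)| ≤ c) :
    |conv K g x - conv K g x'| ≤ (∫ y in Set.Icc (-1 : Fin d → ℝ) 1, |K y|) * c := by
  have hi : ∀ x, IntegrableOn (fun y => K y * g (x - y)) (Set.Icc (-1) 1) := fun x =>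
    integrableOn_cube (by fun_prop)
  rw [conv, conv, ← integral_sub (hi x) (hi x'), ← integral_mul_const, ← Real.norm_eq_abs]
  refine norm_integral_le_of_norm_le ((integrableOn_cube hK.abs).mul_const c)
    (.of_forall fun y => ?_)
  rw [← mul_sub, Real.norm_eq_abs, abs_mul]
  exact mul_le_mul_of_nonneg_left (h y) (abs_nonneg _)

lemma abs_conv_le {d : ℕ} {K g : (Fin d → ℝ) → ℝ} (hK : Continuous K) {c : ℝ}
    (h : ∀ y, |g y| ≤ c) (x : Fin d → ℝ) :
    |conv K g x| ≤ (∫ y in Set.Icc (-1 : Fin d → ℝ) 1, |K y|) * c := by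
  rw [conv, ← integral_mul_const, ← Real.norm_eq_abs]
  refine norm_integral_le_of_norm_le ((integrableOn_cube hK.abs).mul_const c)
    (.of_forall fun y => ?_)
  rw [Real.norm_eq_abs, abs_mul]
  exact mul_le_mul_of_nonneg_left (h _) (abs_nonneg _)

/-- Differentiation under the integral, dominated by `|K|` times a bound for the continuous periodic
derivative. -/
lemma partialD_conv {d : ℕ} {K g : (Fin d → ℝ) → ℝ} (hK : Continuous K) (hg : ContDiff ℝ 1 g)
    (hp : IsPer g) (i : Fin d) : partialD i (conv K g) = conv K (partialD i g) := by
  funext x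
  have hgd : Differentiable ℝ g := hg.differentiable (by simp)
  have hgc := hg.continuous
  have hpc : Continuous (partialD i g) := (contDiff_partialD (m := 0) (by exact_mod_cast hg) i).continuous
  obtain ⟨M, hM⟩ := (hp.partialD i).exists_bound hpc
  set e : Fin d → ℝ := Pi.single i 1
  have hder : ∀ (y : Fin d → ℝ) (t : ℝ), HasDerivAt (fun t : ℝ => K y * g (x + t • e - y))
      (K y * partialD i g (x + t • e - y)) t := fun y t => by
    have h4 : HasDerivAt (fun t : ℝ => x + t • e - y) e t := by
      simpa using (((hasDerivAt_id t).smul_const e).const_add x).sub_const y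
    rw [partialD_eq_fderiv hgd]
    exact ((hgd _).hasFDerivAt.comp_hasDerivAt t h4).const_mul (K y)
  have h := hasDerivAt_integral_of_dominated_loc_of_deriv_le
    (μ := volume.restrict (Set.Icc (-1 : Fin d → ℝ) 1)) (x₀ := (0 : ℝ))
    (F := fun t y => K y * g (x + t • e - y))
    (F' := fun t y => K y * partialD i g (x + t • e - y))
    (bound := fun y => |K y| * M) (s := Set.univ) Filter.univ_mem
    (.of_forall fun t => (Continuous.aestronglyMeasurable (by fun_prop)))
    (integrableOn_cube (by fun_prop))
    (Continuous.aestronglyMeasurable (by fun_prop))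
    (.of_forall fun y t _ => by
      rw [Real.norm_eq_abs, abs_mul]
      exact mul_le_mul_of_nonneg_left (hM _) (abs_nonneg _))
    ((integrableOn_cube hK.abs).mul_const M)
    (.of_forall fun y t _ => hder y t)
  have h2 := h.2.deriv
  simp only [zero_smul, add_zero] at h2
  exact h2

lemma mixedD_conv {d N ν : ℕ} {K g : (Fin d → ℝ) → ℝ} (hK : IsTrig N K) (hg : ContDiff ℝ ν g)
    (hp : IsPer g) {l : List (Fin d)} (hl : l.length ≤ ν) :
    mixedD l (conv K g) = conv K (mixedD l g) := by
  induction l with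
  | nil => rfl
  | cons i l ih =>
    rw [List.length_cons] at hl
    rw [mixedD, ih (by omega), partialD_conv hK.contDiff.continuous ?_ (hp.mixedD l), mixedD]
    exact (contDiff_mixedD_of_le hg (by omega)).of_le (by norm_cast; omega)

/-! The norm of `C_p^{ν,1}`. -/

/-- Below the top order, continuity and periodicity suffice. At order `ν + 1` the Lipschitz constant
bounds the line derivative everywhere, including points where it takes its default value. -/
lemma MemCp.exists_bound {d ν : ℕ} {f : Cube d → ℝ} (hf : MemCp ν f) {l : List (Fin d)}
    (hl : l.length ≤ ν + 1) : ∃ M, ∀ x, |mixedD l (perExt f) x| ≤ M := by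
  rcases hl.eq_or_lt with h | h
  · obtain ⟨i, l, rfl⟩ := List.exists_cons_of_length_eq_add_one h
    obtain ⟨L, hL⟩ := hf.lipschitz l (by simpa using h)
    refine ⟨L * ‖(Pi.single i 1 : Fin d → ℝ)‖, fun x => ?_⟩
    exact norm_lineDeriv_le_of_lipschitz ℝ hL
  · exact ((isPer_perExt f).mixedD l).exists_bound (continuous_mixedD hf.contDiff (by omega))

lemma MemCp.ae_le {d ν : ℕ} {f : Cube d → ℝ} (hf : MemCp ν f) {l : List (Fin d)}
    (hl : l.length ≤ ν + 1) : ∀ᵐ x, |mixedD l (perExt f) x| ≤ cpNorm ν f := by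
  have hfin : Finite {l : List (Fin d) // l.length ≤ ν + 1} :=
    (List.finite_length_le (Fin d) (ν + 1)).to_subtype
  -- Without finiteness `toReal` in `cpNorm` would return `0` and control nothing.
  have htop : (⨆ l : {l : List (Fin d) // l.length ≤ ν + 1},
      eLpNorm (mixedD l.1 (perExt f)) ∞ (volume : Measure (Fin d → ℝ))) ≠ ∞ := by
    have : Nonempty {l : List (Fin d) // l.length ≤ ν + 1} := ⟨⟨[], Nat.zero_le _⟩⟩
    obtain ⟨l₀, h₀⟩ := Finite.exists_max fun l : {l : List (Fin d) // l.length ≤ ν + 1} =>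
      eLpNorm (mixedD l.1 (perExt f)) ∞ (volume : Measure (Fin d → ℝ))
    refine ((iSup_le h₀).trans_lt ?_).ne
    obtain ⟨M, hM⟩ := hf.exists_bound l₀.2
    rw [eLpNorm_exponent_top]
    exact eLpNormEssSup_lt_top_of_ae_bound (C := M) (.of_forall hM)
  have h1 : eLpNorm (mixedD l (perExt f)) ∞ (volume : Measure (Fin d → ℝ))
      ≤ ENNReal.ofReal (cpNorm ν f) := by
    rw [cpNorm, ENNReal.ofReal_toReal htop]
    exact le_iSup (fun l : {l : List (Fin d) // l.length ≤ ν + 1} =>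
      eLpNorm (mixedD l.1 (perExt f)) ∞ (volume : Measure (Fin d → ℝ))) ⟨l, hl⟩
  rw [eLpNorm_exponent_top] at h1
  filter_upwards [ae_le_eLpNormEssSup (f := mixedD l (perExt f)) (μ := volume)] with x hx
  have h2 := hx.trans h1
  rw [← ofReal_norm, Real.norm_eq_abs] at h2
  exact (ENNReal.ofReal_le_ofReal_iff ENNReal.toReal_nonneg).1 h2

lemma cpNorm_nonneg {d : ℕ} (ν : ℕ) (f : Cube d → ℝ) : 0 ≤ cpNorm ν f := ENNReal.toReal_nonneg

lemma cpNorm_le {d ν : ℕ} {f : Cube d → ℝ} {B : ℝ} (hB : 0 ≤ B)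
    (h : ∀ l : List (Fin d), l.length ≤ ν + 1 → ∀ x, |mixedD l (perExt f) x| ≤ B) :
    cpNorm ν f ≤ B := by
  refine ENNReal.toReal_le_of_le_ofReal hB (iSup_le fun l => ?_)
  rw [eLpNorm_exponent_top]
  exact eLpNormEssSup_le_of_ae_bound (.of_forall (h l.1 l.2))

lemma MemCp.mixedD_le {d ν : ℕ} {f : Cube d → ℝ} (hf : MemCp ν f) {l : List (Fin d)}
    (hl : l.length ≤ ν) (x : Fin d → ℝ) : |mixedD l (perExt f) x| ≤ cpNorm ν f :=
  le_of_ae_le (continuous_mixedD hf.contDiff hl) (hf.ae_le (by omega)) x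

lemma MemCp.mixedD_sub_le {d ν : ℕ} {f : Cube d → ℝ} (hf : MemCp ν f) {l : List (Fin d)}
    (hl : l.length = ν) (x v : Fin d → ℝ) :
    |mixedD l (perExt f) (x + v) - mixedD l (perExt f) x| ≤ cpNorm ν f * ∑ i, |v i| := by
  obtain ⟨L, hL⟩ := hf.lipschitz l hl
  exact abs_sub_le_of_ae_partialD_le hL
    (fun i => hf.ae_le (l := i :: l) (by rw [List.length_cons, hl])) x v

lemma MemCp.continuous {d ν : ℕ} {f : Cube d → ℝ} (hf : MemCp ν f) : Continuous f := by
  have h := hf.contDiff.continuous.comp (continuous_subtype_val (p := (· ∈ Set.Icc (-1) 1)))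
  convert h using 1
  funext z
  exact (hf.perExt_eq z).symm

lemma MemCp.circConv {d N ν : ℕ} {K : (Fin d → ℝ) → ℝ} (hK : IsTrig N K) {f : Cube d → ℝ}
    (hf : MemCp ν f) : MemCp ν (circConv K f) where
  perExt_eq z := by rw [perExt_circConv]; rfl
  contDiff := by
    rw [perExt_circConv]
    exact (hK.conv (isPer_perExt f) hf.contDiff.continuous).contDiff.of_le le_top
  lipschitz l hl := by
    obtain ⟨L, hL⟩ := hf.lipschitz l hl
    have h0 : 0 ≤ ∫ y in Set.Icc (-1 : Fin d → ℝ) 1, |K y| := integral_nonneg fun y => abs_nonneg _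
    refine ⟨Real.toNNReal (∫ y in Set.Icc (-1 : Fin d → ℝ) 1, |K y|) * L,
       LipschitzWith.of_dist_le_mul fun x x' => ?_⟩
    rw [perExt_circConv, mixedD_conv hK hf.contDiff (isPer_perExt f) hl.le, Real.dist_eq]
    refine (abs_conv_sub_le hK.contDiff.continuous hL.continuous
      (c := L * dist x x') fun y => ?_).trans (le_of_eq ?_)
    · have := hL.dist_le_mul (x - y) (x' - y)
      rwa [dist_sub_right, Real.dist_eq] at this
    · rw [NNReal.coe_mul, Real.coe_toNNReal _ h0, mul_assoc]

/-- Up to order `ν` the derivatives pass onto `f`. At order `ν + 1` only `ν` of them are passed on,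
and the last is bounded through the increments of the resulting Lipschitz function. -/
lemma cpNorm_circConv_le {d N ν : ℕ} {K : (Fin d → ℝ) → ℝ} (hK : IsTrig N K) {f : Cube d → ℝ}
    (hf : MemCp ν f) :
    cpNorm ν (circConv K f) ≤ (∫ y in Set.Icc (-1 : Fin d → ℝ) 1, |K y|) * cpNorm ν f := by
  have h0 : 0 ≤ ∫ y in Set.Icc (-1 : Fin d → ℝ) 1, |K y| := integral_nonneg fun y => abs_nonneg _
  have hKc := hK.contDiff.continuous
  have hp := isPer_perExt f
  refine cpNorm_le (mul_nonneg h0 (cpNorm_nonneg ν f)) fun l hl x => ?_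
  rw [perExt_circConv]
  rcases hl.eq_or_lt with h | h
  · obtain ⟨i, l, rfl⟩ := List.exists_cons_of_length_eq_add_one h
    have hl' : l.length = ν := by simpa using h
    rw [mixedD, mixedD_conv hK hf.contDiff hp hl'.le]
    change ‖deriv (fun t : ℝ => conv K (mixedD l (perExt f)) (x + t • Pi.single i 1)) 0‖ ≤ _
    refine norm_deriv_le_of_lip' (mul_nonneg h0 (cpNorm_nonneg ν f)) (.of_forall fun t => ?_)
    rw [zero_smul, add_zero, sub_zero, mul_assoc, Real.norm_eq_abs]
    refine abs_conv_sub_le hKc (continuous_mixedD hf.contDiff hl'.le) fun y => ?_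
    have h1 := hf.mixedD_sub_le hl' (x - y) (t • Pi.single i 1)
    have h2 : ∑ j, |(t • (Pi.single i 1 : Fin d → ℝ)) j| = ‖t‖ := by
      rw [Finset.sum_eq_single i (fun j _ hj => by simp [hj]) (by simp)]
      simp
    rwa [h2, show x - y + t • Pi.single i 1 = x + t • Pi.single i 1 - y by abel] at h1
  · rw [mixedD_conv hK hf.contDiff hp (by omega)]
    exact abs_conv_le hKc (fun y => hf.mixedD_le (by omega) y) x

/-! The Jackson kernel. -/

/-- `∑_{j < n} e^{iπjy}`. -/
def expSum (n : ℕ) (y : ℝ) : ℂ := ∑ j ∈ Finset.range n, circ (j * y)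

@[fun_prop] lemma continuous_expSum (n : ℕ) : Continuous (expSum n) := by
  unfold expSum
  fun_prop

lemma norm_expSum_le (n : ℕ) (y : ℝ) : ‖expSum n y‖ ≤ n := by
  refine (norm_sum_le _ _).trans ?_
  simp

/-- The trivial bound `n` contributes `1`; the geometric sum bound `2 / |1 - e^{iπy}|`, with `|1 -
e^{iπy}| ≥ |y| / 2`, contributes `4`. -/
lemma norm_expSum_mul_le {n : ℕ} (hn : 0 < n) {y : ℝ} (hy : |y| ≤ 1) :
    ‖expSum n y‖ * (1 / n + |y|) ≤ 5 := by
  have hn' : (0 : ℝ) < n := by exact_mod_cast hn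
  have h1 : ‖expSum n y‖ * (1 / n) ≤ 1 := by
    rw [mul_one_div, div_le_one hn']
    exact norm_expSum_le n y
  have h2 : ‖expSum n y‖ * ‖1 - circ y‖ ≤ 2 := by
    rw [← norm_mul, expSum]
    simp only [circ_nat_mul]
    have h3 : (∑ j ∈ Finset.range n, circ y ^ j) * (1 - circ y) = 1 - circ y ^ n := by
      linear_combination -(geom_sum_mul (circ y) n)
    rw [h3]
    refine (norm_sub_le _ _).trans ?_
    rw [norm_one, norm_pow, norm_circ, one_pow]
    norm_num
  have h3 := le_norm_one_sub_circ (r := 1) (by norm_num) hy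
  rw [sub_self, zero_add, Complex.ofReal_one, one_mul] at h3
  have h4 := mul_le_mul_of_nonneg_left h3 (norm_nonneg (expSum n y))
  linarith

/-- The normalizing constant of the Jackson kernel. -/
def jacksonMass (n : ℕ) : ℝ := ∫ y in (-1 : ℝ)..1, ‖expSum n y‖ ^ 4

lemma jacksonMass_ge {n : ℕ} (hn : 0 < n) : (n : ℝ) ^ 3 / 48 ≤ jacksonMass n := by
  have hn' : (1 : ℝ) ≤ n := by exact_mod_cast hn
  have hc : Continuous fun y => ‖expSum n y‖ ^ 4 := by fun_prop
  -- On this interval all phases `πjy` lie in `[0, π/3]`, so each term has real part at least `1/2`.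
  have h1 : ∀ y ∈ Set.Icc (0 : ℝ) (1 / (3 * n)), (n / 2 : ℝ) ^ 4 ≤ ‖expSum n y‖ ^ 4 := by
    intro y hy
    refine pow_le_pow_left₀ (by positivity) (le_trans ?_ (Complex.re_le_norm _)) 4
    rw [expSum, Complex.re_sum]
    have : (n / 2 : ℝ) = ∑ j ∈ Finset.range n, (1 / 2 : ℝ) := by simp; ring
    rw [this]
    refine Finset.sum_le_sum fun j hj => ?_
    have hj' : (j : ℝ) ≤ n := by exact_mod_cast (Finset.mem_range.1 hj).le
    have h2 : (circ (j * y)).re = Real.cos (Real.pi * (j * y)) := by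
      rw [circ_eq]
      simp [-Complex.ofReal_cos, -Complex.ofReal_sin, -Complex.ofReal_mul]
    rw [h2, ← Real.cos_pi_div_three]
    have h3 : (j : ℝ) * y ≤ 1 / 3 := by
      calc (j : ℝ) * y ≤ n * (1 / (3 * n)) := mul_le_mul hj' hy.2 hy.1 (by positivity)
        _ = 1 / 3 := by field_simp
    refine Real.cos_le_cos_of_nonneg_of_le_pi
      (mul_nonneg Real.pi_pos.le (mul_nonneg j.cast_nonneg hy.1)) ?_ ?_
    · linarith [Real.pi_pos]
    · nlinarith [Real.pi_pos]
  have h5 : (1 : ℝ) / (3 * n) ≤ 1 := by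
    rw [div_le_one (by positivity)]; linarith
  calc (n : ℝ) ^ 3 / 48 = ∫ y in (0 : ℝ)..(1 / (3 * n)), (n / 2 : ℝ) ^ 4 := by
        rw [intervalIntegral.integral_const, smul_eq_mul]
        field_simp
        norm_num
    _ ≤ ∫ y in (0 : ℝ)..(1 / (3 * n)), ‖expSum n y‖ ^ 4 :=
        intervalIntegral.integral_mono_on (by positivity) (by simp) (hc.intervalIntegrable _ _) h1
    _ ≤ _ := intervalIntegral.integral_mono_interval (by norm_num) (by positivity) h5
        (.of_forall fun y => by positivity) (hc.intervalIntegrable _ _)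

/-- The fourth power of `norm_expSum_mul_le` gives `625 = 5^4`; the factor `|y|` uses up one power
of `1/n + |y|`, and the exponent `-3` is left to integrate. -/
lemma integral_abs_mul_expSum_le {n : ℕ} (hn : 0 < n) :
    ∫ y in (-1 : ℝ)..1, |y| * ‖expSum n y‖ ^ 4 ≤ 625 * (n : ℝ) ^ 2 := by
  have hn' : (0 : ℝ) < n := by exact_mod_cast hn
  have hδ : (0 : ℝ) < 1 / n := by positivity
  have h0 : ∀ y : ℝ, 0 < 1 / (n : ℝ) + |y| := fun y =>
    add_pos_of_pos_of_nonneg hδ (abs_nonneg y)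
  calc ∫ y in (-1 : ℝ)..1, |y| * ‖expSum n y‖ ^ 4
      ≤ ∫ y in (-1 : ℝ)..1, 625 * (1 / n + |y|) ^ (-3 : ℝ) := by
        refine intervalIntegral.integral_mono_on (by norm_num)
          (Continuous.intervalIntegrable (by fun_prop) _ _)
          (Continuous.intervalIntegrable ?_ _ _) fun y hy => ?_
        · exact continuous_const.mul ((continuous_const.add continuous_abs).rpow_const fun t =>
            Or.inl (h0 t).ne')
        · have h1 := norm_expSum_mul_le hn (abs_le.2 hy)
          have h2 : (1 / (n : ℝ) + |y|) ^ (-3 : ℝ) = ((1 / (n : ℝ) + |y|) ^ 3)⁻¹ := by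
            rw [Real.rpow_neg (h0 y).le]; norm_cast
          rw [h2, ← div_eq_mul_inv, le_div_iff₀ (by have := h0 y; positivity)]
          have h3 : (‖expSum n y‖ * (1 / n + |y|)) ^ 4 ≤ 5 ^ 4 :=
            pow_le_pow_left₀ (mul_nonneg (norm_nonneg _) (h0 y).le) h1 4
          calc |y| * ‖expSum n y‖ ^ 4 * (1 / n + |y|) ^ 3
              ≤ (1 / n + |y|) * ‖expSum n y‖ ^ 4 * (1 / n + |y|) ^ 3 := by
                have := h0 y
                gcongr
                linarith
            _ = (‖expSum n y‖ * (1 / n + |y|)) ^ 4 := by ring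
            _ ≤ 625 := by linarith
    _ ≤ 625 * (2 / (3 - 1) * (1 / n : ℝ) ^ (1 - 3 : ℝ)) := by
        rw [intervalIntegral.integral_const_mul]
        gcongr
        exact integral_add_abs_rpow hδ (by norm_num)
    _ = _ := by
        rw [show (1 - 3 : ℝ) = -2 by norm_num, Real.rpow_neg hδ.le, Real.div_rpow zero_le_one hn'.le,
          Real.one_rpow, one_div, inv_inv]
        norm_num

/-- The Jackson kernel on the cube. -/
def jacksonKernel (d n : ℕ) (y : Fin d → ℝ) : ℝ := ∏ i, ‖expSum n (y i)‖ ^ 4 / jacksonMass n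

lemma norm_expSum_pow (n : ℕ) (y : ℝ) : ((‖expSum n y‖ ^ 4 : ℝ) : ℂ) =
    ∑ q ∈ (Finset.range n ×ˢ Finset.range n) ×ˢ (Finset.range n ×ˢ Finset.range n),
      circ (((q.1.1 + q.1.2 - q.2.1 - q.2.2 : ℤ) : ℝ) * y) := by
  have hstar : ∀ t, (starRingEnd ℂ) (circ t) = circ (-t) := fun t => by
    rw [circ_neg, Complex.inv_def, Complex.normSq_eq_norm_sq, norm_circ]
    simp
  have h1 : ((‖expSum n y‖ ^ 4 : ℝ) : ℂ) =
      (expSum n y * expSum n y) * ((starRingEnd ℂ) (expSum n y) * (starRingEnd ℂ) (expSum n y)) := by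
    have := Complex.mul_conj' (expSum n y)
    push_cast
    linear_combination (-(‖expSum n y‖ : ℂ) ^ 2 - expSum n y * (starRingEnd ℂ) (expSum n y)) * this
  have h2 : (starRingEnd ℂ) (expSum n y) = ∑ j ∈ Finset.range n, circ (-(j * y)) := by
    rw [expSum, map_sum]
    simp only [hstar]
  rw [h1, h2, expSum, Finset.sum_mul_sum, Finset.sum_mul_sum, ← Finset.sum_product',
    ← Finset.sum_product', Finset.sum_mul_sum, ← Finset.sum_product']
  refine Finset.sum_congr rfl fun q _ => ?_
  rw [← circ_add, ← circ_add, ← circ_add]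
  congr 1
  push_cast
  ring

/-- Each coordinate contributes frequencies `j₁ + j₂ - j₃ - j₄` with `0 ≤ j ≤ n - 1`, of modulus at
most `2(n - 1)`. -/
lemma isTrig_jacksonKernel {d n N : ℕ} (h : 2 * (n - 1) * d ≤ N) :
    IsTrig N (jacksonKernel d n) := by
  set Q := (Finset.range n ×ˢ Finset.range n) ×ˢ (Finset.range n ×ˢ Finset.range n)
  set φ : (ℕ × ℕ) × (ℕ × ℕ) → ℤ := fun q => q.1.1 + q.1.2 - q.2.1 - q.2.2
  have h1 : (fun y : Fin d → ℝ => (jacksonKernel d n y : ℂ)) =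
      ((jacksonMass n : ℂ)⁻¹ ^ d) • ∑ q ∈ Fintype.piFinset fun _ : Fin d => Q,
        expo fun i => φ (q i) := by
    funext y
    simp only [jacksonKernel, Complex.ofReal_prod, Complex.ofReal_div, norm_expSum_pow,
      Finset.prod_div_distrib, Finset.prod_univ_sum, Pi.smul_apply, Finset.sum_apply, smul_eq_mul,
      expo]
    rw [Finset.prod_const, Finset.card_univ, Fintype.card_fin, inv_pow, mul_comm, div_eq_mul_inv]
  unfold IsTrig
  rw [h1]
  refine Submodule.smul_mem _ _ (Submodule.sum_mem _ fun q hq => expo_mem_trigSpan ?_)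
  rw [mem_freqs]
  have h2 : ∀ i, |φ (q i)| ≤ (2 * (n - 1) : ℕ) := fun i => by
    have := Fintype.mem_piFinset.1 hq i
    simp only [Q, Finset.mem_product, Finset.mem_range] at this
    simp only [φ]
    rw [abs_le]
    constructor <;> omega
  refine (Finset.sum_le_sum fun i _ => h2 i).trans ?_
  rw [Finset.sum_const, Finset.card_univ, Fintype.card_fin, nsmul_eq_mul, mul_comm]
  exact_mod_cast h

lemma jacksonKernel_nonneg (d n : ℕ) (y : Fin d → ℝ) : 0 ≤ jacksonKernel d n y :=
  Finset.prod_nonneg fun i _ => div_nonneg (by positivity)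
    (intervalIntegral.integral_nonneg (by norm_num) fun y _ => by positivity)

lemma integral_expSum_div {n : ℕ} (hn : 0 < n) :
    ∫ y in (-1 : ℝ)..1, ‖expSum n y‖ ^ 4 / jacksonMass n = 1 := by
  have hn' : (0 : ℝ) < n := by exact_mod_cast hn
  have : 0 < jacksonMass n := lt_of_lt_of_le (by positivity) (jacksonMass_ge hn)
  rw [intervalIntegral.integral_div, ← jacksonMass, div_self this.ne']

lemma integral_jacksonKernel {d n : ℕ} (hn : 0 < n) :
    ∫ y in Set.Icc (-1 : Fin d → ℝ) 1, jacksonKernel d n y = 1 := by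
  unfold jacksonKernel
  rw [integral_cube_prod fun _ t => ‖expSum n t‖ ^ 4 / jacksonMass n]
  simp [integral_expSum_div hn]

lemma continuous_jacksonKernel (d n : ℕ) : Continuous (jacksonKernel d n) :=
  (isTrig_jacksonKernel le_rfl).contDiff.continuous

lemma integral_jacksonKernel_mul_abs {d n : ℕ} (hn : 0 < n) :
    ∫ y in Set.Icc (-1 : Fin d → ℝ) 1, jacksonKernel d n y * ∑ j, |y j| ≤ d * (30000 / n) := by
  have hn' : (0 : ℝ) < n := by exact_mod_cast hn
  have hJ := continuous_jacksonKernel d n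
  simp only [Finset.mul_sum]
  rw [integral_finsetSum _ fun j _ => integrableOn_cube (by fun_prop)]
  have h1 : ∀ j, ∫ y in Set.Icc (-1 : Fin d → ℝ) 1, jacksonKernel d n y * |y j| ≤ 30000 / n := by
    intro j
    have h2 : ∀ y : Fin d → ℝ, jacksonKernel d n y * |y j| = ∏ i,
        (if i = j then |y i| else 1) * (‖expSum n (y i)‖ ^ 4 / jacksonMass n) := fun y => by
      rw [Finset.prod_mul_distrib, ← jacksonKernel, Finset.prod_ite_eq' Finset.univ j]
      simp [mul_comm]
    simp only [h2]
    rw [integral_cube_prod fun i t => (if i = j then |t| else 1) *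
      (‖expSum n t‖ ^ 4 / jacksonMass n), Finset.prod_eq_single j]
    · have h3 := jacksonMass_ge hn
      have h4 : 0 < jacksonMass n := lt_of_lt_of_le (by positivity) h3
      simp only [if_true, ← mul_div_assoc]
      rw [intervalIntegral.integral_div, div_le_div_iff₀ h4 hn']
      have h5 := integral_abs_mul_expSum_le hn
      calc _ ≤ 625 * (n : ℝ) ^ 2 * n := by gcongr
        -- `30000 = 625 * 48` combines the moment bound with the lower bound for the mass.
        _ = 30000 * ((n : ℝ) ^ 3 / 48) := by ring
        _ ≤ _ := by gcongr
    · intro i _ hi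
      simp only [hi, if_false, one_mul]
      exact integral_expSum_div hn
    · simp
  refine (Finset.sum_le_sum fun j _ => h1 j).trans ?_
  simp

/-! Iterated remainders. -/

/-- `(I - J)^k g`, where `J` is convolution with `K`. -/
def remainder {d : ℕ} (K : (Fin d → ℝ) → ℝ) : ℕ → ((Fin d → ℝ) → ℝ) → (Fin d → ℝ) → ℝ
  | 0, g => g
  | k + 1, g => remainder K k g - conv K (remainder K k g)

section

variable {d N : ℕ} {K : (Fin d → ℝ) → ℝ}

lemma isPer_contDiff_remainder (hK : IsTrig N K) {m : ℕ} {g : (Fin d → ℝ) → ℝ} (hp : IsPer g)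
    (hg : ContDiff ℝ m g) (k : ℕ) : IsPer (remainder K k g) ∧ ContDiff ℝ m (remainder K k g) := by
  induction k with
  | zero => exact ⟨hp, hg⟩
  | succ k ih =>
    have h := hK.conv ih.1 ih.2.continuous
    refine ⟨fun n x => ?_, ih.2.sub (h.contDiff.of_le le_top)⟩
    simp only [remainder, Pi.sub_apply, ih.1 n x, h.isPer n x]

lemma isTrig_sub_remainder (hK : IsTrig N K) {g : (Fin d → ℝ) → ℝ} (hp : IsPer g)
    (hg : Continuous g) (k : ℕ) : IsTrig N (g - remainder K k g) := by
  induction k with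
  | zero =>
    rw [remainder, sub_self]
    exact isTrig_zero
  | succ k ih =>
    have h := isPer_contDiff_remainder hK (m := 0) hp (by exact_mod_cast contDiff_zero.2 hg) k
    have := ih.add (hK.conv h.1 h.2.continuous)
    convert this using 1
    rw [remainder]
    abel

lemma partialD_remainder (hK : IsTrig N K) {g : (Fin d → ℝ) → ℝ} (hp : IsPer g)
    (hg : ContDiff ℝ 1 g) (i : Fin d) (k : ℕ) :
    partialD i (remainder K k g) = remainder K k (partialD i g) := by
  induction k with
  | zero => rfl
  | succ k ih =>
    have h := isPer_contDiff_remainder hK (m := 1) hp (by exact_mod_cast hg) k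
    have hd : Differentiable ℝ (remainder K k g) := h.2.differentiable (by simp)
    have hd2 : Differentiable ℝ (conv K (remainder K k g)) :=
      (hK.conv h.1 h.2.continuous).contDiff.differentiable (by simp)
    rw [remainder, remainder, ← ih, ← partialD_conv hK.contDiff.continuous
      (by exact_mod_cast h.2) h.1, partialD_eq_fderiv (hd.sub hd2), partialD_eq_fderiv hd,
      partialD_eq_fderiv hd2]
    funext x
    rw [fderiv_sub (hd x) (hd2 x)]
    rfl

/-- As `K` has mass one, the difference is a `K`-average of the increments `h x - h (x - y)`. -/
lemma abs_sub_conv_le (hK : Continuous K) (hK0 : ∀ y, 0 ≤ K y)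
    (hK1 : ∫ y in Set.Icc (-1 : Fin d → ℝ) 1, K y = 1) {h : (Fin d → ℝ) → ℝ} (hc : Continuous h)
    {B : ℝ} (hB : ∀ x v, |h (x + v) - h x| ≤ B * ∑ i, |v i|) (x : Fin d → ℝ) :
    |h x - conv K h x| ≤ (∫ y in Set.Icc (-1 : Fin d → ℝ) 1, K y * ∑ i, |y i|) * B := by
  have h1 : h x - conv K h x = ∫ y in Set.Icc (-1 : Fin d → ℝ) 1, K y * (h x - h (x - y)) := by
    simp only [mul_sub]
    rw [integral_sub (integrableOn_cube (by fun_prop)) (integrableOn_cube (by fun_prop)),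
      integral_mul_const, hK1, one_mul, conv]
  rw [h1, ← integral_mul_const, ← Real.norm_eq_abs]
  have hi : IntegrableOn (fun y : Fin d → ℝ => K y * ∑ i, |y i|) (Set.Icc (-1) 1) :=
    integrableOn_cube (by fun_prop)
  refine norm_integral_le_of_norm_le (hi.mul_const B)
    (.of_forall fun y => ?_)
  rw [Real.norm_eq_abs, abs_mul, abs_of_nonneg (hK0 y), mul_assoc]
  refine mul_le_mul_of_nonneg_left ?_ (hK0 y)
  have := hB (x - y) y
  rwa [sub_add_cancel, mul_comm] at this

/-- Induction on the smoothness: the partial derivatives of a remainder are remainders of partial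
derivatives, so the inductive bound serves as a Lipschitz constant, and one more application of `I -
J` gains one more first moment. -/
lemma abs_remainder_le (hK : IsTrig N K) (hK0 : ∀ y, 0 ≤ K y)
    (hK1 : ∫ y in Set.Icc (-1 : Fin d → ℝ) 1, K y = 1) (ν : ℕ) {g : (Fin d → ℝ) → ℝ}
    (hp : IsPer g) (hg : ContDiff ℝ ν g) {B : ℝ} (hB : ∀ l : List (Fin d), l.length = ν →
      ∀ x v, |mixedD l g (x + v) - mixedD l g x| ≤ B * ∑ i, |v i|) (x : Fin d → ℝ) :
    |remainder K (ν + 1) g x| ≤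
      (∫ y in Set.Icc (-1 : Fin d → ℝ) 1, K y * ∑ i, |y i|) ^ (ν + 1) * B := by
  have hKc := hK.contDiff.continuous
  induction ν generalizing g x with
  | zero =>
    rw [zero_add, pow_one]
    exact abs_sub_conv_le hKc hK0 hK1 hg.continuous (hB [] rfl) x
  | succ ν ih =>
    obtain ⟨h1, h2⟩ := isPer_contDiff_remainder hK hp hg (ν + 1)
    have hg1 : ContDiff ℝ 1 g := hg.of_le (by norm_cast; omega)
    have h3 := abs_sub_le_of_partialD_le (h2.of_le (by norm_cast; omega)) fun i x => by
      rw [partialD_remainder hK hp hg1]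
      refine ih (hp.partialD i) (contDiff_partialD hg i) (fun l hl => ?_) x
      rw [← mixedD_append]
      exact hB _ (by simp [hl])
    rw [remainder, Pi.sub_apply, pow_succ', mul_assoc]
    exact abs_sub_conv_le hKc hK0 hK1 h2.continuous h3 x

end

/-- Jackson's inequality. -/
lemma exists_isJacksonConst (d ν : ℕ) : ∃ K : ℝ, IsJacksonConst d ν K := by
  refine ⟨(60000 * d * (d + 1)) ^ (ν + 1), fun N hN f hf => ?_⟩
  have hN' : (0 : ℝ) < N := by exact_mod_cast hN
  -- Small enough for total degree `2(n - 1)d ≤ N`, yet `n ≥ N / (2(d + 1))`, so the first moment is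
  -- `O(1/N)`.
  set n := N / (2 * (d + 1)) + 1 with hn
  have hn0 : 0 < n := Nat.succ_pos _
  have hn0' : (0 : ℝ) < n := by exact_mod_cast hn0
  have hdeg : 2 * (n - 1) * d ≤ N := by
    have h1 := Nat.div_mul_le_self N (2 * (d + 1))
    have h2 : n - 1 = N / (2 * (d + 1)) := by omega
    rw [h2]
    nlinarith
  have hnN : (N : ℝ) ≤ 2 * (d + 1) * n := by
    have h1 := Nat.lt_mul_div_succ N (show 0 < 2 * (d + 1) by omega)
    have h2 : N ≤ 2 * (d + 1) * n := h1.le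
    exact_mod_cast h2
  set K := jacksonKernel d n
  have hK : IsTrig N K := isTrig_jacksonKernel hdeg
  set E := ∫ y in Set.Icc (-1 : Fin d → ℝ) 1, K y * ∑ i, |y i|
  have hE0 : 0 ≤ E := integral_nonneg fun y => mul_nonneg (jacksonKernel_nonneg d n y)
    (Finset.sum_nonneg fun i _ => abs_nonneg _)
  have hE : E ≤ 60000 * d * (d + 1) / N := by
    refine (integral_jacksonKernel_mul_abs hn0).trans ?_
    rw [mul_div_assoc', div_le_div_iff₀ hn0' hN']
    have := mul_le_mul_of_nonneg_left hnN (show (0 : ℝ) ≤ d * 30000 by positivity)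
    linarith
  have hp := isPer_perExt f
  have hR := abs_remainder_le hK (jacksonKernel_nonneg d n) (integral_jacksonKernel hn0) ν hp
    hf.contDiff fun l hl => hf.mixedD_sub_le hl
  have ht := (isTrig_sub_remainder hK hp hf.contDiff.continuous (ν + 1)).mem_trigPoly
  -- The competitor is `f - (I - J)^{ν+1} f`, whose error is the remainder itself.
  refine (ciInf_le ⟨0, ?_⟩ ⟨_, ht⟩).trans (Real.iSup_le (fun z => ?_) ?_)
  · rintro _ ⟨t, rfl⟩
    exact Real.iSup_nonneg fun z => abs_nonneg _
  · have h1 : (perExt f - remainder K (ν + 1) (perExt f)) z.1 - f z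
        = -remainder K (ν + 1) (perExt f) z.1 := by
      rw [Pi.sub_apply, hf.perExt_eq z]
      ring
    rw [h1, abs_neg]
    refine (hR z.1).trans (mul_le_mul_of_nonneg_right ?_ (cpNorm_nonneg ν f))
    rw [← div_pow]
    exact pow_le_pow_left₀ hE0 hE _
  · exact mul_nonneg (by positivity) (cpNorm_nonneg ν f)

/-! ### Signs of the constants and near-best approximation -/

lemma mixedD_const {d : ℕ} (l : List (Fin d)) (c : ℝ) :
    mixedD l (fun _ : Fin d → ℝ => c) = fun _ => if l = [] then c else 0 := by
  induction l with
  | nil => rfl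
  | cons i l ih =>
    funext x
    simp [mixedD, ih, partialD, lineDeriv]

lemma memCp_const {d : ℕ} (ν : ℕ) (c : ℝ) : MemCp ν (fun _ : Cube d => c) where
  perExt_eq _ := rfl
  contDiff := contDiff_const
  lipschitz l _ := ⟨0, by
    change LipschitzWith 0 (mixedD l fun _ => c)
    rw [mixedD_const]
    exact LipschitzWith.const _⟩

lemma cpNorm_zero {d : ℕ} (ν : ℕ) : cpNorm ν (0 : Cube d → ℝ) = 0 := by
  refine le_antisymm (cpNorm_le le_rfl fun l _ x => ?_) (cpNorm_nonneg ν _)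
  change |mixedD l (fun _ => 0) x| ≤ 0
  simp [mixedD_const]

/-- Tested on the constant function `1`, whose norm is positive. -/
lemma IsJacksonConst.nonneg {d ν : ℕ} {K : ℝ} (hK : IsJacksonConst d ν K) : 0 ≤ K := by
  have hf := memCp_const (d := d) ν 1
  have h1 := hK 1 one_pos _ hf
  have h2 : 1 ≤ cpNorm ν fun _ : Cube d => (1 : ℝ) := by
    have := hf.mixedD_le (l := []) (Nat.zero_le _) 0
    simpa [mixedD, perExt] using this
  have h3 : (0 : ℝ) ≤ ⨅ t : trigPoly d 1, ⨆ z : Cube d, |t.1 z - 1| :=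
    Real.iInf_nonneg fun t => Real.iSup_nonneg fun z => abs_nonneg _
  have h4 := h3.trans h1
  rw [Nat.cast_one, one_pow, div_one] at h4
  exact nonneg_of_mul_nonneg_left h4 (by linarith)

/-- The kernel reproduces constants, so its integral is `1`. -/
lemma IsVPBound.one_le {d : ℕ} {Λ : ℝ} (hΛ : IsVPBound d Λ) : 1 ≤ Λ := by
  have h1 := hΛ 2 two_pos even_two
  have h2 := vpKernel_expo (d := d) (N := 2) even_two (j := 0) (by simp [mem_freqs]) 0
  simp only [expo, Pi.zero_apply, Int.cast_zero, zero_mul, circ_zero, Finset.prod_const_one,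
    mul_one] at h2
  have h3 := norm_integral_le_integral_norm (μ := volume.restrict (Set.Icc (-1 : Fin d → ℝ) 1))
    fun y => (vpKernel d 2 y : ℂ)
  rw [h2, norm_one] at h3
  simp only [Complex.norm_real, Real.norm_eq_abs] at h3
  exact h3.trans h1

lemma continuous_perExt_of_mem_trigPoly {d N : ℕ} {t : Cube d → ℝ} (ht : t ∈ trigPoly d N) :
    Continuous (perExt t) ∧ Continuous t := by
  obtain ⟨T, hT, h⟩ := exists_trigSpan_of_mem_trigPoly ht
  have hc : Continuous fun x => (T x).re :=
    Complex.continuous_re.comp (contDiff_of_mem_trigSpan hT).continuous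
  constructor
  · convert hc using 1
    funext x
    rw [← (isPer_of_mem_trigSpan hT).wrap x, h, Complex.ofReal_re, perExt]
  · convert hc.comp continuous_subtype_val using 1
    funext z
    rw [Function.comp_apply, h, Complex.ofReal_re]

/-- Near-best approximation by the de la Vallée-Poussin sums. -/
lemma abs_circConv_vpKernel_sub_le {d ν N : ℕ} {Λ K : ℝ} (hΛ : IsVPBound d Λ)
    (hK : IsJacksonConst d ν K) (hN : 0 < N) (hev : Even N) {f : Cube d → ℝ} (hf : MemCp ν f)
    (z : Cube d) : |circConv (vpKernel d N) f z - f z| ≤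
      (1 + Λ) * (K * 2 ^ (ν + 1) / (N : ℝ) ^ (ν + 1) * cpNorm ν f) := by
  have hΛ1 := hΛ.one_le
  have hN2 : 0 < N / 2 := by
    obtain ⟨m, rfl⟩ := hev
    omega
  have hcast : ((N / 2 : ℕ) : ℝ) = N / 2 := by
    rw [Nat.cast_div hev.two_dvd two_ne_zero, Nat.cast_ofNat]
  have hJ := hK (N / 2) hN2 f hf
  rw [hcast, div_pow, div_div_eq_mul_div] at hJ
  have hvp := (isTrig_vpKernel d N).contDiff.continuous
  rw [← div_le_iff₀' (by linarith)]
  -- No best approximant is needed: every `b` above the infimum is attained or beaten by some `t`.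
  refine le_of_forall_gt_imp_ge_of_dense fun b hb => ?_
  obtain ⟨t, ht⟩ := exists_lt_of_ciInf_lt (hJ.trans_lt hb)
  rw [div_le_iff₀' (by linarith)]
  obtain ⟨htp, htc⟩ := continuous_perExt_of_mem_trigPoly t.2
  -- Compactness makes the supremum a genuine one rather than the default `0`.
  have h1 : ∀ z, |t.1 z - f z| ≤ b := fun z =>
    (le_ciSup (f := fun z => |t.1 z - f z|)
      (isCompact_range (htc.sub hf.continuous).abs).bddAbove z).trans ht.le
  have h2 : circConv (vpKernel d N) f z - f z
      = conv (vpKernel d N) (perExt f - perExt t.1) z.1 + (t.1 z - f z) := by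
    have hfp := hf.contDiff.continuous
    have h3 := circConv_vpKernel hev t.2 z
    have h4 : conv (vpKernel d N) (perExt f - perExt t.1) z.1
        = circConv (vpKernel d N) f z - circConv (vpKernel d N) t.1 z := by
      simp only [conv, circConv, Pi.sub_apply, mul_sub]
      exact integral_sub (integrableOn_cube (by fun_prop)) (integrableOn_cube (by fun_prop))
    rw [h4, h3]
    ring
  rw [h2]
  refine (abs_add_le _ _).trans ?_
  have h5 := abs_conv_le hvp (g := perExt f - perExt t.1) (c := b)
    (fun y => by rw [Pi.sub_apply, abs_sub_comm]; exact h1 _) z.1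
  have h6 : 0 ≤ b := (abs_nonneg _).trans (h1 z)
  have h7 := mul_le_mul_of_nonneg_right (hΛ N hN hev) h6
  linarith [h1 z]

/-! The Bellman operator. -/

lemma continuous_join {dS dA : ℕ} :
    Continuous fun q : Cube dS × Cube dA => join q.1 q.2 := by
  refine Continuous.subtype_mk (continuous_pi fun i => ?_) _
  induction i using Fin.addCases with
  | left i =>
    simp only [Fin.append_left]
    exact (continuous_apply i).comp (continuous_subtype_val.comp continuous_fst)
  | right i =>
    simp only [Fin.append_right]
    exact (continuous_apply i).comp (continuous_subtype_val.comp continuous_snd)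

instance nonempty_cube (d : ℕ) : Nonempty (Cube d) := ⟨⟨0, by simp [Set.mem_Icc]⟩⟩

lemma bddAbove_join {dS dA : ℕ} {f : Cube (dS + dA) → ℝ} (hf : Continuous f) (s : Cube dS) :
    BddAbove (Set.range fun a : Cube dA => f (join s a)) :=
  (isCompact_range (hf.comp (continuous_join.comp (by fun_prop :
    Continuous fun a : Cube dA => (s, a))))).bddAbove

lemma continuous_iSup_join {dS dA : ℕ} {f : Cube (dS + dA) → ℝ} (hf : Continuous f) :
    Continuous fun s : Cube dS => ⨆ a : Cube dA, f (join s a) := by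
  have h := (isCompact_univ (X := Cube dA)).continuous_sSup
    (f := fun (s : Cube dS) a => f (join s a)) (hf.comp continuous_join)
  simp only [Set.image_univ] at h
  exact h

namespace MDP

variable {dS dA : ℕ}

/-- The Bellman operator is a contraction for the uniform norm. -/
lemma abs_bellman_sub_le (M : MDP dS dA) (h : ℕ) {f g : Cube (dS + dA) → ℝ} (hf : Continuous f)
    (hg : Continuous g) {c : ℝ} (hc : ∀ z, |f z - g z| ≤ c) (z : Cube (dS + dA)) :
    |M.bellman h f z - M.bellman h g z| ≤ c := by
  have := M.markov h
  have hi : ∀ {f : Cube (dS + dA) → ℝ}, Continuous f →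
      Integrable (fun s : Cube dS => ⨆ a : Cube dA, f (join s a)) (M.trans h z) := fun hf =>
    (continuous_iSup_join hf).integrable_of_hasCompactSupport (HasCompactSupport.of_compactSpace _)
  have hle : ∀ {f g : Cube (dS + dA) → ℝ}, Continuous g → (∀ z, |f z - g z| ≤ c) → ∀ s : Cube dS,
      (⨆ a : Cube dA, f (join s a)) ≤ (⨆ a : Cube dA, g (join s a)) + c := fun hg hc s =>
    ciSup_le fun a => by
      have h1 := le_ciSup (bddAbove_join hg s) a
      have h2 := (abs_le.1 (hc (join s a))).2
      linarith
  rw [bellman, bellman, add_sub_add_left_eq_sub, ← integral_sub (hi hf) (hi hg),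
    ← Real.norm_eq_abs]
  refine (norm_integral_le_of_norm_le_const (C := c) (.of_forall fun s => ?_)).trans (by simp)
  rw [Real.norm_eq_abs, abs_sub_le_iff]
  have h1 := hle hg hc s
  have h2 := hle hf (fun z => by rw [abs_sub_comm]; exact hc z) s
  constructor <;> linarith

/-! ### Induction over the stages -/

variable {M : MDP dS dA} {ν N : ℕ} {Λ K C : ℝ}

lemma IsSmooth.memCp_optQAux (hM : M.IsSmooth ν C) {k : ℕ} (hk : k ≤ M.H) :
    MemCp ν (M.optQAux k) := by
  induction k with
  | zero => exact memCp_const ν 0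
  | succ k ih => exact (hM _ (by omega) (Nat.sub_le _ _) _ (ih (by omega))).1

/-- Tested on `f = 0`. For `H = 0` smoothness is vacuous and says nothing about `C`. -/
lemma IsSmooth.nonneg (hM : M.IsSmooth ν C) (hH : 1 ≤ M.H) : 0 ≤ C := by
  have h := (hM 1 le_rfl hH 0 (memCp_const ν 0)).2
  rw [cpNorm_zero] at h
  have := (cpNorm_nonneg ν _).trans h
  linarith

lemma sum_pow_succ (a : ℝ) (k : ℕ) :
    ∑ j ∈ Finset.Icc 1 (k + 1), a ^ j = a * (∑ j ∈ Finset.Icc 1 k, a ^ j + 1) := by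
  induction k with
  | zero => simp
  | succ k ih =>
    rw [Finset.sum_Icc_succ_top (by omega : 1 ≤ k + 1 + 1)]
    nth_rewrite 1 [ih]
    rw [Finset.sum_Icc_succ_top (by omega : 1 ≤ k + 1)]
    ring

/-- Each stage costs `C(S + 1)` for the Bellman operator and `Λ` for the convolution; `sum_pow_succ`
is this recursion. -/
lemma IsSmooth.projQAux_bound (hM : M.IsSmooth ν C) (hΛ : IsVPBound (dS + dA) Λ) (hN : 0 < N)
    (hev : Even N) {k : ℕ} (hk : k ≤ M.H) : MemCp ν (M.projQAux N k) ∧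
      cpNorm ν (M.projQAux N k) ≤ ∑ j ∈ Finset.Icc 1 k, (Λ * C) ^ j := by
  induction k with
  | zero =>
    refine ⟨memCp_const ν 0, le_of_eq ?_⟩
    rw [projQAux, cpNorm_zero]
    simp
  | succ k ih =>
    obtain ⟨h1, h2⟩ := ih (by omega)
    obtain ⟨h3, h4⟩ := hM (M.H - k) (by omega) (Nat.sub_le _ _) _ h1
    have hC := hM.nonneg (by omega)
    have hΛ1 := hΛ.one_le
    refine ⟨h3.circConv (isTrig_vpKernel _ N), ?_⟩
    refine (cpNorm_circConv_le (isTrig_vpKernel _ N) h3).trans ?_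
    rw [sum_pow_succ, mul_assoc]
    refine mul_le_mul (hΛ N hN hev) (h4.trans ?_) (cpNorm_nonneg ν _) (by linarith)
    gcongr

/-- A stage adds a fresh projection error, proportional to the current geometric sum, to the
previous error. These sums increase with `k`, so the last one bounds all stages and the factor `k`
counts them. -/
lemma IsSmooth.abs_projQAux_sub_le (hM : M.IsSmooth ν C) (hΛ : IsVPBound (dS + dA) Λ)
    (hK : IsJacksonConst (dS + dA) ν K) (hN : 0 < N) (hev : Even N) {k : ℕ} (hk : k ≤ M.H)
    (z : Cube (dS + dA)) : |M.projQAux N k z - M.optQAux k z| ≤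
      (2 ^ (ν + 2) * K * k * ∑ j ∈ Finset.Icc 1 k, (Λ * C) ^ j) / (N : ℝ) ^ (ν + 1) := by
  induction k generalizing z with
  | zero => simp [projQAux, optQAux]
  | succ k ih =>
    obtain ⟨h1, h2⟩ := hM.projQAux_bound hΛ hN hev (k := k) (by omega)
    obtain ⟨h3, h4⟩ := hM (M.H - k) (by omega) (Nat.sub_le _ _) _ h1
    have hC := hM.nonneg (by omega)
    have hΛ1 := hΛ.one_le
    have hK0 := hK.nonneg
    have hN' : (0 : ℝ) < N := by exact_mod_cast hN
    have e1 := abs_circConv_vpKernel_sub_le hΛ hK hN hev h3 z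
    have e2 := M.abs_bellman_sub_le (M.H - k) h1.continuous
      (hM.memCp_optQAux (k := k) (by omega)).continuous (ih (by omega)) z
    set S := ∑ j ∈ Finset.Icc 1 k, (Λ * C) ^ j with hS
    have hS0 : 0 ≤ S := Finset.sum_nonneg fun j _ => by positivity
    have hS1 : S ≤ Λ * C * (S + 1) := by
      rw [← sum_pow_succ, Finset.sum_Icc_succ_top (by omega)]
      have : 0 ≤ (Λ * C) ^ (k + 1) := by positivity
      linarith
    rw [sum_pow_succ, ← hS]
    rw [projQAux, optQAux]
    refine (abs_sub_le _ (M.bellman (M.H - k) (M.projQAux N k) z) _).trans ?_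
    -- From `Λ ≥ 1`, `1 + Λ ≤ 2Λ`: this supplies the extra factor `2` in `2 ^ (ν + 2)` and the `Λ`
    -- that completes `Λ * C * (S + 1)`.
    have e3 : (1 + Λ) * (K * 2 ^ (ν + 1) / (N : ℝ) ^ (ν + 1) *
        cpNorm ν (M.bellman (M.H - k) (M.projQAux N k))) ≤
        (2 * Λ) * (K * 2 ^ (ν + 1) / (N : ℝ) ^ (ν + 1) * (C * (S + 1))) := by
      gcongr
      · exact mul_nonneg (by positivity) (cpNorm_nonneg ν _)
      · linarith
      · exact h4.trans (by gcongr)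
    have e4 : (2 ^ (ν + 2) * K * k * S) / (N : ℝ) ^ (ν + 1) ≤
        (2 ^ (ν + 2) * K * k * (Λ * C * (S + 1))) / (N : ℝ) ^ (ν + 1) := by
      gcongr
    refine (add_le_add (e1.trans e3) (e2.trans e4)).trans (le_of_eq ?_)
    push_cast
    ring

end MDP

end ProjQ
end

theorem mainTheorem4 :
    (∀ d : ℕ, ∃ Λ : ℝ, ProjQ.IsVPBound d Λ) ∧
    (∀ d ν : ℕ, ∃ K : ℝ, ProjQ.IsJacksonConst d ν K) ∧
    ∀ (dS dA ν : ℕ) (Λ K C : ℝ),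
      ProjQ.IsVPBound (dS + dA) Λ → ProjQ.IsJacksonConst (dS + dA) ν K →
      ∀ M : ProjQ.MDP dS dA, M.IsSmooth ν C →
      ∀ N : ℕ, 0 < N → Even N → ∀ h : ℕ, 1 ≤ h → h ≤ M.H + 1 →
        (ProjQ.MemCp ν (M.projQ N h) ∧
          ProjQ.cpNorm ν (M.projQ N h) ≤ ∑ k ∈ Finset.Icc 1 (M.H + 1 - h), (Λ * C) ^ k) ∧
        ∀ z : ProjQ.Cube (dS + dA),
          |M.projQ N h z - M.optQ h z| ≤
            (2 ^ (ν + 2) * K * ((M.H + 1 - h : ℕ) : ℝ) *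
              ∑ k ∈ Finset.Icc 1 (M.H + 1 - h), (Λ * C) ^ k) / (N : ℝ) ^ (ν + 1) := by
  refine ⟨ProjQ.exists_isVPBound, ProjQ.exists_isJacksonConst, ?_⟩
  intro dS dA ν Λ K C hΛ hK M hM N hN hev h h1 _
  exact ⟨hM.projQAux_bound hΛ hN hev (by omega),
    fun z => hM.abs_projQAux_sub_le hΛ hK hN hev (by omega) z⟩
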